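/- Let $\mathbb{F}_8$ be the field with $8$ elements, $I=\langle Y^3+X^3Y+X\rangle\subseteq\mathbb{F}_8[X,Y]$ and $I_8=I+\langle X^8-X,\,Y^8-Y\rangle$. Order the monomials by $X^{i_1}Y^{j_1}\prec_w X^{i_2}Y^{j_2}$ iff $2i_1+3j_1<2i_2+3j_2$, or $2i_1+3j_1=2i_2+3j_2$ and $j_1<j_2$. Let $\Delta=\{M_1\prec_w M_2\prec_w\cdots\prec_w M_{22}\}$ be the footprint of $I_8$, that is, the set of monomials that are not the leading monomial of any nonzero polynomial in $I_8$. Let $P_1,\dots,P_{22}$ be the points of $\mathbb{V}(I_8)$ and put $\mathrm{ev}(F)=(F(P_1),\dots,F(P_{22}))$. For $L\subseteq\Delta$ let $C^\perp(I,L)\subseteq\mathbb{F}_8^{22}$ be the dual, with respect to the standard bilinear form, of $\mathrm{Span}\{\mathrm{ev}(M)\mid M\in L\}$, and let $C(s)=C^\perp(I,\{M_1,\dots,M_s\})$. Write $w_H$ for the Hamming weight, $d(C)$ for the minimum distance of $C$, and $d(C',C'')=\min\{w_H(c)\mid c\in C'\setminus C''\}$ for the relative distance. 1. For $i=7,10,11,13,14,15,16,17,18,19,20,21,22$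 the relative distance $d(C(i-1),C(i))$ equals $3,6,8,9,11,12,12,14,15,15,17,18,21$, respectively. 2. $d(C^\perp(I,L))=3$ whenever $\{M_1,M_2,M_3\}\subseteq L\subseteq\{M_1,\dots,M_6\}$, and $d(C^\perp(I,L))=6$ whenever $\{M_1,\dots,M_7\}\subseteq L\subseteq\{M_1,\dots,M_9\}$. 3. $d(C(3))=d(C(4))=d(C(5))=d(C(6))=3$, $d(C(7))=d(C(8))=d(C(9))=6$, $d(C(10))=8$, $d(C(12))=9$, $d(C(13))=11$, $d(C(14))=d(C(15))=12$, $d(C(16))=14$, $d(C(18))=15$, $d(C(19))=17$, $d(C(20))=18$ and $d(C(21))=21$. 4. The following words have the stated weights: - for every set $A\subseteq\mathbb{F}_8\setminus\{0\}$ with $(\#A,i,w)$ one of $(6,7,3)$, $(5,10,6)$, $(4,13,9)$, $(3,16,12)$, $(2,19,15)$, $(1,21,18)$, $(0,22,21)$, the word $\mathrm{ev}\big(Y\prod_{a\in A}(X-a)\big)$ lies in $C(i-1)\setminus C(i)$ and has weight $w$; - for every $\alpha\in\mathbb{F}_8$ with $\alpha^3+\alpha^2+1=0$ and every set $A\subseteq\{\alpha,\alpha^2+\alpha,\alpha^2+\alpha+1\}$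 with $(\#A,i,w)$ one of $(3,11,8)$, $(2,14,11)$, $(1,17,14)$, $(0,20,17)$, the word $\mathrm{ev}\big(Y(X+Y+\alpha)\prod_{a\in A}(X-a)\big)$ lies in $C(i-1)\setminus C(i)$ and has weight $w$; - for every such $\alpha$, the word $\mathrm{ev}\big(\alpha X^3Y+\alpha XY^2+(\alpha^2+\alpha+1)Y^2+(\alpha^2+\alpha+1)XY+(\alpha+1)Y+X\big)$ lies in $C(14)\setminus C(15)$ and has weight $12$, and the word $\mathrm{ev}(\alpha X^2Y+1)$ lies in $C(17)\setminus C(18)$ and has weight $15$. -/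

import Mathlib

open MvPolynomial
open scoped MonomialOrder

noncomputable section

/-! ### Affine variety codes -/

section General

variable {σ : Type*} {K : Type*} [Field K]

/-- The footprint `Δ_≺(J)`: the (exponents of) monomials that are not the leading monomial of any
nonzero polynomial in `J`. -/
def footprint (m : MonomialOrder σ) (J : Ideal (MvPolynomial σ K)) : Set (σ →₀ ℕ) :=
  {a | ∀ f ∈ J, f ≠ 0 → m.degree f ≠ a}

/-- `I_q = I + ⟨X_i ^ q - X_i⟩`, where `q` is the number of elements of the field. -/
def fieldIdeal (I : Ideal (MvPolynomial σ K)) : Ideal (MvPolynomial σ K) :=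
  I ⊔ Ideal.span (Set.range fun i : σ => (X i : MvPolynomial σ K) ^ Nat.card K - X i)

/-- The points `P_1, …, P_n` of `𝕍(I_q)`, which index the coordinates of the words. -/
abbrev Points (I : Ideal (MvPolynomial σ K)) : Type _ :=
  {P : σ → K // P ∈ zeroLocus K (fieldIdeal I)}

instance instFintypePoints [Finite σ] [Finite K] (I : Ideal (MvPolynomial σ K)) :
    Fintype (Points I) :=
  Fintype.ofFinite _

/-- The evaluation map `F ↦ (F(P_1), …, F(P_n))`. -/
def ev (I : Ideal (MvPolynomial σ K)) : MvPolynomial σ K →ₗ[K] (Points I → K) :=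
  LinearMap.pi fun P => (aeval (R := K) P.1).toLinearMap

/-- The primary affine variety code `C(I, L) = Span {ev(M) | M ∈ L}`. -/
def primaryCode (I : Ideal (MvPolynomial σ K)) (L : Set (σ →₀ ℕ)) : Submodule K (Points I → K) :=
  Submodule.span K ((fun a => ev I (monomial a 1)) '' L)

/-- The dual of a linear code with respect to the standard bilinear form. -/
def dualCode {ι : Type*} [Fintype ι] (C : Submodule K (ι → K)) : Submodule K (ι → K) where
  carrier := {c | ∀ b ∈ C, c ⬝ᵥ b = 0}
  zero_mem' := fun b _ => zero_dotProduct b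
  add_mem' := fun {c d} hc hd b hb => by rw [add_dotProduct, hc b hb, hd b hb, add_zero]
  smul_mem' := fun r c hc b hb => by rw [smul_dotProduct, hc b hb, smul_zero]

/-- The dual affine variety code `C^⊥(I, L)`. -/
def dualAffineCode [Finite σ] [Finite K] (I : Ideal (MvPolynomial σ K)) (L : Set (σ →₀ ℕ)) :
    Submodule K (Points I → K) :=
  dualCode (primaryCode I L)

/-- `{M_1, …, M_s}`, where `Δ_≺(I_q) = {M_1 ≺ M_2 ≺ ⋯ ≺ M_n}`: the monomials of the footprint with
fewer than `s` predecessors in the footprint. -/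
def firstMonomials (m : MonomialOrder σ) (I : Ideal (MvPolynomial σ K)) (s : ℕ) : Set (σ →₀ ℕ) :=
  {a ∈ footprint m (fieldIdeal I) | {b ∈ footprint m (fieldIdeal I) | b ≺[m] a}.ncard < s}

/-- `C(s) = C^⊥(I, {M_1, …, M_s})`. -/
def dualSeqCode [Finite σ] [Finite K] (m : MonomialOrder σ) (I : Ideal (MvPolynomial σ K))
    (s : ℕ) : Submodule K (Points I → K) :=
  dualAffineCode I (firstMonomials m I s)

/-- The Hamming weight `w_H(c)`. -/
def weight {ι : Type*} [Fintype ι] (c : ι → K) : ℕ :=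
  haveI := Classical.decEq K
  hammingNorm c

/-- The minimum distance `d(C)`: the least weight of a nonzero word (and `0` if there is none). -/
def minDist {ι : Type*} [Fintype ι] (C : Submodule K (ι → K)) : ℕ :=
  sInf {w | ∃ c ∈ C, c ≠ 0 ∧ weight c = w}

/-- The relative distance `d(C', C'')`: the least weight of a word in `C' \ C''` (and `0` if there
is none). -/
def relDist {ι : Type*} [Fintype ι] (C' C'' : Submodule K (ι → K)) : ℕ :=
  sInf {w | ∃ c ∈ C', c ∉ C'' ∧ weight c = w}

end General

/-! ### The weighted graded ordering -/

/-- Exponents `(i, j)` of monomials `X^i Y^j`, ordered by `2i + 3j` and then by `j`. -/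
def WSyn : Type := Fin 2 →₀ ℕ

instance : AddCommMonoid WSyn := inferInstanceAs (AddCommMonoid (Fin 2 →₀ ℕ))

/-- The pair `(2i + 3j, j)`. -/
def WSyn.key (a : Fin 2 →₀ ℕ) : ℕ ×ₗ ℕ := toLex (2 * a 0 + 3 * a 1, a 1)

theorem WSyn.key_injective : Function.Injective WSyn.key := by
  intro a b h
  have h' := congrArg ofLex h
  simp only [WSyn.key, ofLex_toLex, Prod.mk.injEq] at h'
  ext i
  fin_cases i
  · show a 0 = b 0
    omega
  · exact h'.2

theorem WSyn.key_add (a b : Fin 2 →₀ ℕ) : WSyn.key (a + b) = WSyn.key a + WSyn.key b := by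
  rw [WSyn.key, WSyn.key, WSyn.key, ← toLex_add, Prod.mk_add_mk]
  simp only [Finsupp.add_apply]
  congr 2
  ring

instance : LinearOrder WSyn :=
  LinearOrder.lift' (WSyn.key : (Fin 2 →₀ ℕ) → ℕ ×ₗ ℕ) WSyn.key_injective

instance : IsOrderedAddMonoid WSyn where
  add_le_add_left := fun (a b : Fin 2 →₀ ℕ) h (c : Fin 2 →₀ ℕ) => by
    show WSyn.key (a + c) ≤ WSyn.key (b + c)
    rw [WSyn.key_add, WSyn.key_add]
    exact add_le_add_left (show WSyn.key a ≤ WSyn.key b from h) _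

instance : WellFoundedLT WSyn :=
  ⟨InvImage.wf (WSyn.key : (Fin 2 →₀ ℕ) → ℕ ×ₗ ℕ) wellFounded_lt⟩

/-- The weighted graded ordering `≺_w` on monomials `X^i Y^j`. -/
def wOrder : MonomialOrder (Fin 2) where
  syn := WSyn
  toSyn :=
    { toFun := fun a => (show WSyn from a)
      invFun := fun a => (show Fin 2 →₀ ℕ from a)
      left_inv := fun _ => rfl
      right_inv := fun _ => rfl
      map_add' := fun _ _ => rfl }
  toSyn_monotone := fun a b h => by
    have h0 := h 0
    have h1 := h 1
    show WSyn.key a ≤ WSyn.key b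
    rw [WSyn.key, WSyn.key, Prod.Lex.toLex_le_toLex]
    simp only
    omega

/-- `X^{i₁} Y^{j₁} ≺_w X^{i₂} Y^{j₂}` iff `2i₁ + 3j₁ < 2i₂ + 3j₂`, or equality and `j₁ < j₂`. -/
theorem wOrder_lt_iff (a b : Fin 2 →₀ ℕ) :
    a ≺[wOrder] b ↔ 2 * a 0 + 3 * a 1 < 2 * b 0 + 3 * b 1 ∨
      (2 * a 0 + 3 * a 1 = 2 * b 0 + 3 * b 1 ∧ a 1 < b 1) := by
  show WSyn.key a < WSyn.key b ↔ _
  rw [WSyn.key, WSyn.key, Prod.Lex.toLex_lt_toLex]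

/-! ### The Klein quartic -/

section Klein

variable (F : Type*) [Field F]

/-- The ideal `I = ⟨Y³ + X³Y + X⟩`, with `X = X 0` and `Y = X 1`. -/
def kleinIdeal : Ideal (MvPolynomial (Fin 2) F) :=
  Ideal.span {(X 1 ^ 3 + X 0 ^ 3 * X 1 + X 0 : MvPolynomial (Fin 2) F)}

/-- `{M_1, …, M_s}` for the Klein quartic and `≺_w`. -/
abbrev kleinMonomials (s : ℕ) : Set (Fin 2 →₀ ℕ) := firstMonomials wOrder (kleinIdeal F) s

/-- The dual code `C(s)` from the Klein quartic. -/
abbrev kleinCode [Finite F] (s : ℕ) : Submodule F (Points (kleinIdeal F) → F) :=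
  dualSeqCode wOrder (kleinIdeal F) s

variable {F}

/-- `ev(f)` lies in `C(i-1) \ C(i)` and has Hamming weight `w`. -/
def IsKleinWord [Finite F] (f : MvPolynomial (Fin 2) F) (i w : ℕ) : Prop :=
  ev (kleinIdeal F) f ∈ kleinCode F (i - 1) ∧ ev (kleinIdeal F) f ∉ kleinCode F i ∧
    weight (ev (kleinIdeal F) f) = w

end Klein

end

/-! ### A concrete model of the field with eight elements -/

/-- The triple `(a, b, c)` stands for `a + b α + c α²`, where `α³ = α² + 1`. -/
def GF8 : Type := ZMod 2 × ZMod 2 × ZMod 2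

namespace GF8

instance : DecidableEq GF8 := inferInstanceAs (DecidableEq (ZMod 2 × ZMod 2 × ZMod 2))
instance : Fintype GF8 := inferInstanceAs (Fintype (ZMod 2 × ZMod 2 × ZMod 2))
instance : AddCommGroup GF8 := inferInstanceAs (AddCommGroup (ZMod 2 × ZMod 2 × ZMod 2))

instance : One GF8 := ⟨((1, 0, 0) : ZMod 2 × ZMod 2 × ZMod 2)⟩

instance : Mul GF8 := ⟨fun (a b : ZMod 2 × ZMod 2 × ZMod 2) =>
  ((a.1 * b.1 + (a.2.1 * b.2.2 + a.2.2 * b.2.1) + a.2.2 * b.2.2,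
    a.1 * b.2.1 + a.2.1 * b.1 + a.2.2 * b.2.2,
    a.1 * b.2.2 + a.2.1 * b.2.1 + a.2.2 * b.1 + (a.2.1 * b.2.2 + a.2.2 * b.2.1)
      + a.2.2 * b.2.2) : ZMod 2 × ZMod 2 × ZMod 2)⟩

instance : CommRing GF8 where
  __ := (inferInstance : AddCommGroup GF8)
  one_mul := by decide +kernel
  mul_one := by decide +kernel
  zero_mul := by decide +kernel
  mul_zero := by decide +kernel
  mul_assoc := by decide +kernel
  mul_comm := by decide +kernel
  left_distrib := by decide +kernel
  right_distrib := by decide +kernel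

/-- The generator `α` with `α³ + α² + 1 = 0`. -/
def gen : GF8 := ((0, 1, 0) : ZMod 2 × ZMod 2 × ZMod 2)

theorem exists_mul_eq_one : ∀ x : GF8, x ≠ 0 → ∃ y, x * y = 1 := by decide +kernel

theorem card_eq : Fintype.card GF8 = 8 := by decide +kernel

theorem exists_ringHom {F : Type*} [Field F] [CharP F 2] (α : F) (hα : α ^ 3 + α ^ 2 + 1 = 0) :
    ∃ φ : GF8 →+* F, φ gen = α := by
  have h2 : (2 : F) = 0 := CharTwo.two_eq_zero
  let ι : ZMod 2 →+* F := ZMod.castHom dvd_rfl F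
  refine ⟨{ toFun := fun (a : ZMod 2 × ZMod 2 × ZMod 2) => ι a.1 + ι a.2.1 * α + ι a.2.2 * α ^ 2
            map_one' := ?_, map_mul' := ?_, map_zero' := ?_, map_add' := ?_ }, ?_⟩
  · show ι 1 + ι 0 * α + ι 0 * α ^ 2 = 1
    simp
  · rintro ⟨a, b, c⟩ ⟨d, e, f⟩
    show ι (a * d + (b * f + c * e) + c * f) + ι (a * e + b * d + c * f) * α +
      ι (a * f + b * e + c * d + (b * f + c * e) + c * f) * α ^ 2 =
        (ι a + ι b * α + ι c * α ^ 2) * (ι d + ι e * α + ι f * α ^ 2)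
    simp only [map_add, map_mul]
    linear_combination (-(ι b * ι f + ι c * ι e) - ι c * ι f * (α + 1)) * hα +
      ((ι b * ι f + ι c * ι e) * (1 + α ^ 2) + ι c * ι f * (1 + α + α ^ 2 + α ^ 3)) * h2
  · show ι 0 + ι 0 * α + ι 0 * α ^ 2 = 0
    simp
  · rintro ⟨a, b, c⟩ ⟨d, e, f⟩
    show ι (a + d) + ι (b + e) * α + ι (c + f) * α ^ 2 =
      (ι a + ι b * α + ι c * α ^ 2) + (ι d + ι e * α + ι f * α ^ 2)
    simp only [map_add]
    ring
  · show ι 0 + ι 1 * α + ι 0 * α ^ 2 = α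
    simp

theorem exists_ringEquiv {F : Type*} [Field F] [Finite F] (hF : Nat.card F = 8) [CharP F 2] (α : F)
    (hα : α ^ 3 + α ^ 2 + 1 = 0) : ∃ φ : GF8 ≃+* F, φ gen = α := by
  obtain ⟨φ, hφ⟩ := exists_ringHom α hα
  have hinj : Function.Injective φ := by
    rw [injective_iff_map_eq_zero]
    intro x hx
    by_contra h
    obtain ⟨y, hy⟩ := exists_mul_eq_one x h
    have := congrArg φ hy
    rw [map_mul, hx, zero_mul, map_one] at this
    exact zero_ne_one this
  have hbij : Function.Bijective φ := by
    have := Fintype.ofFinite F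
    rw [Fintype.bijective_iff_injective_and_card]
    exact ⟨hinj, by rw [card_eq, ← Nat.card_eq_fintype_card, hF]⟩
  exact ⟨RingEquiv.ofBijective φ hbij, hφ⟩

end GF8

theorem charP_two_of_card_eq_eight {F : Type*} [Field F] [Finite F] (hF : Nat.card F = 8) :
    CharP F 2 := by
  have := Fintype.ofFinite F
  obtain ⟨p, hp⟩ := CharP.exists F
  obtain ⟨n, hprime, hn⟩ := FiniteField.card F p
  rw [← Nat.card_eq_fintype_card, hF] at hn
  have hdvd : p ∣ 2 ^ 3 := by
    rw [show 2 ^ 3 = p ^ (n : ℕ) from hn]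
    exact dvd_pow_self p n.ne_zero
  rwa [← (Nat.prime_dvd_prime_iff_eq hprime Nat.prime_two).1 (hprime.dvd_of_dvd_pow hdvd)]

theorem pow_eight_of_card_eq_eight {F : Type*} [Field F] [Finite F] (hF : Nat.card F = 8) (x : F) :
    x ^ 8 = x := by
  have := Fintype.ofFinite F
  rw [← hF, Nat.card_eq_fintype_card, FiniteField.pow_card]

theorem exists_cubic_root {F : Type*} [Field F] [Finite F] (hF : Nat.card F = 8) :
    ∃ α : F, α ^ 3 + α ^ 2 + 1 = 0 := by
  have := charP_two_of_card_eq_eight hF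
  have h2 : (2 : F) = 0 := CharTwo.two_eq_zero
  have := Fintype.ofFinite F
  classical
  obtain ⟨x, hx⟩ : ∃ x : F, x ∉ ({0, 1} : Finset F) := by
    by_contra! h
    have h1 := Finset.card_le_card (fun x _ => h x : Finset.univ ⊆ ({0, 1} : Finset F))
    rw [Finset.card_univ, ← Nat.card_eq_fintype_card, hF] at h1
    exact absurd (h1.trans Finset.card_le_two) (by norm_num)
  simp only [Finset.mem_insert, Finset.mem_singleton, not_or] at hx
  have h : (x * (x - 1)) * ((x ^ 3 + x ^ 2 + 1) * (x ^ 3 + x + 1)) = 0 := by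
    linear_combination pow_eight_of_card_eq_eight hF x + (x ^ 5 - x ^ 4) * h2
  rcases mul_eq_zero.1 h with h | h
  · exact absurd h (mul_ne_zero hx.1 (sub_ne_zero.2 hx.2))
  · rcases mul_eq_zero.1 h with h | h
    · exact ⟨x, h⟩
    · exact ⟨x + 1, by linear_combination h + (2 * x ^ 2 + 2 * x + 1) * h2⟩

/-! ### A rank bound for the Hamming weight -/

theorem weight_eq_card {ι K : Type*} [Field K] [Fintype ι] [DecidableEq K] (c : ι → K) :
    weight c = Fintype.card {i // c i ≠ 0} := by
  rw [weight, Fintype.card_subtype]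
  simp only [hammingNorm]

theorem le_weight_of_triangular {ι K : Type*} [Field K] [Fintype ι] (c : ι → K) {w : ℕ}
    (f g : Fin w → ι → K) (hdiag : ∀ u, ∑ P, c P * (f u P * g u P) ≠ 0)
    (hzero : ∀ u v, u < v → ∑ P, c P * (f u P * g v P) = 0) : w ≤ weight c := by
  classical
  let M : Matrix (Fin w) (Fin w) K :=
    Matrix.of f * Matrix.diagonal c * (Matrix.of g).transpose
  have hM : ∀ u v, M u v = ∑ P, c P * (f u P * g v P) := fun u v => by
    show (Matrix.of f * Matrix.diagonal c * (Matrix.of g).transpose) u v = _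
    rw [Matrix.mul_apply]
    simp only [Matrix.mul_diagonal, Matrix.transpose_apply, Matrix.of_apply]
    exact Finset.sum_congr rfl fun P _ => by ring
  have hdet : M.det ≠ 0 := by
    rw [Matrix.det_of_isLowerTriangular M fun u v huv => by
      rw [hM]; exact hzero u v huv]
    exact Finset.prod_ne_zero_iff.2 fun u _ => by rw [hM]; exact hdiag u
  have hrank : M.rank = w := by
    rw [Matrix.rank_of_isUnit M ((Matrix.isUnit_iff_isUnit_det M).2 (isUnit_iff_ne_zero.2 hdet)),
      Fintype.card_fin]
  rw [weight_eq_card, ← Matrix.rank_diagonal]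
  calc w = M.rank := hrank.symm
    _ ≤ (Matrix.of f * Matrix.diagonal c).rank := Matrix.rank_mul_le_left _ _
    _ ≤ (Matrix.diagonal c).rank := Matrix.rank_mul_le_right _ _

/-! ### Minimum and relative distances -/

section Distances

variable {ι K : Type*} [Field K] [Fintype ι]

theorem relDist_eq {C' C'' : Submodule K (ι → K)} {w : ℕ}
    (hle : ∀ c ∈ C', c ∉ C'' → w ≤ weight c) (hw : ∃ c ∈ C', c ∉ C'' ∧ weight c = w) :
    relDist C' C'' = w :=
  IsLeast.csInf_eq ⟨hw, by rintro _ ⟨c, h1, h2, rfl⟩; exact hle c h1 h2⟩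

theorem minDist_eq {C : Submodule K (ι → K)} {w : ℕ}
    (hle : ∀ c ∈ C, c ≠ 0 → w ≤ weight c) (hw : ∃ c ∈ C, c ≠ 0 ∧ weight c = w) :
    minDist C = w :=
  IsLeast.csInf_eq ⟨hw, by rintro _ ⟨c, h1, h2, rfl⟩; exact hle c h1 h2⟩

end Distances

theorem dualAffineCode_anti {σ K : Type*} [Field K] [Finite σ] [Finite K]
    {I : Ideal (MvPolynomial σ K)} {L L' : Set (σ →₀ ℕ)} (h : L ⊆ L') :
    dualAffineCode I L' ≤ dualAffineCode I L :=
  fun _ hc b hb => hc b (Submodule.span_mono (Set.image_mono h) hb)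

theorem mem_dualAffineCode_iff {σ K : Type*} [Field K] [Finite σ] [Finite K]
    {I : Ideal (MvPolynomial σ K)} {L : Set (σ →₀ ℕ)} {c : Points I → K} :
    c ∈ dualAffineCode I L ↔ ∀ a ∈ L, c ⬝ᵥ ev I (monomial a 1) = 0 := by
  refine ⟨fun h a ha => h _ (Submodule.subset_span ⟨a, ha, rfl⟩), fun h b hb => ?_⟩
  induction hb using Submodule.span_induction with
  | mem x hx => obtain ⟨a, ha, rfl⟩ := hx; exact h a ha
  | zero => exact dotProduct_zero c
  | add x y _ _ hx hy => rw [dotProduct_add, hx, hy, add_zero]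
  | smul r x _ hx => rw [dotProduct_smul, hx, smul_zero]

/-! ### The affine points of the Klein quartic -/

section KleinPoints

variable {F : Type*} [Field F] [Finite F]

theorem mem_zeroLocus_kleinIdeal_iff (P : Fin 2 → F) :
    P ∈ zeroLocus F (fieldIdeal (kleinIdeal F)) ↔ P 1 ^ 3 + P 0 ^ 3 * P 1 + P 0 = 0 := by
  have := Fintype.ofFinite F
  constructor
  · intro h
    have := h (X 1 ^ 3 + X 0 ^ 3 * X 1 + X 0)
      (Ideal.mem_sup_left (Ideal.subset_span (Set.mem_singleton _)))
    simpa using this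
  · intro h
    have hle : fieldIdeal (kleinIdeal F) ≤ RingHom.ker (aeval (R := F) P) := by
      rw [fieldIdeal, kleinIdeal, sup_le_iff, Ideal.span_le, Ideal.span_le]
      refine ⟨?_, ?_⟩
      · rintro _ rfl
        simpa using h
      · rintro _ ⟨i, rfl⟩
        simp [Nat.card_eq_fintype_card, FiniteField.pow_card]
    exact fun p hp => hle hp

theorem Points.curve_eq (P : Points (kleinIdeal F)) :
    P.1 1 ^ 3 + P.1 0 ^ 3 * P.1 1 + P.1 0 = 0 :=
  (mem_zeroLocus_kleinIdeal_iff P.1).1 P.2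

/-- The affine points of the Klein quartic over `GF8`. -/
def kleinPoints : Finset (GF8 × GF8) :=
  Finset.univ.filter fun p => p.2 ^ 3 + p.1 ^ 3 * p.2 + p.1 = 0

/-- The affine points over `F` and over the concrete model `GF8` correspond to each other. -/
def pointsEquiv (φ : GF8 ≃+* F) : kleinPoints ≃ Points (kleinIdeal F) where
  toFun p := ⟨![φ p.1.1, φ p.1.2], (mem_zeroLocus_kleinIdeal_iff _).2 (by
    have h := congrArg φ (Finset.mem_filter.1 p.2).2
    simpa using h)⟩
  invFun P := ⟨(φ.symm (P.1 0), φ.symm (P.1 1)), Finset.mem_filter.2 ⟨Finset.mem_univ _, by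
    have h := congrArg φ.symm P.curve_eq
    simpa using h⟩⟩
  left_inv p := by simp
  right_inv P := by
    ext i
    fin_cases i <;> simp

theorem sum_points {M : Type*} [AddCommMonoid M] (φ : GF8 ≃+* F) (f : F → F → M) :
    ∑ P : Points (kleinIdeal F), f (P.1 0) (P.1 1) = ∑ p ∈ kleinPoints, f (φ p.1) (φ p.2) := by
  rw [← Finset.sum_coe_sort kleinPoints]
  exact (Equiv.sum_comp (pointsEquiv φ) _).symm

theorem weight_ev (φ : GF8 ≃+* F) (f : MvPolynomial (Fin 2) F) (g : GF8 → GF8 → GF8)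
    (hfg : ∀ x y, aeval (R := F) ![φ x, φ y] f = φ (g x y)) :
    weight (ev (kleinIdeal F) f) = (kleinPoints.filter fun p => g p.1 p.2 ≠ 0).card := by
  classical
  rw [weight_eq_card, Fintype.card_subtype, Finset.card_filter, Finset.card_filter,
    ← Finset.sum_coe_sort kleinPoints]
  refine (Equiv.sum_comp (pointsEquiv φ) _).symm.trans (Finset.sum_congr rfl fun p _ => ?_)
  have : ev (kleinIdeal F) f (pointsEquiv φ p) = φ (g p.1.1 p.1.2) := hfg p.1.1 p.1.2
  rw [this]
  simp

theorem card_kleinPoints : kleinPoints.card = 22 := by decide +kernel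

theorem card_points (φ : GF8 ≃+* F) : Fintype.card (Points (kleinIdeal F)) = 22 := by
  rw [← Fintype.card_congr (pointsEquiv φ), Fintype.card_coe, card_kleinPoints]

end KleinPoints

/-! ### Pairing words with monomials -/

section Pairing

variable {F : Type*} [Field F] [Finite F]

/-- The product of the word `c` with `ev (X ^ a * Y ^ b)`. -/
noncomputable def pairing (c : Points (kleinIdeal F) → F) (a b : ℕ) : F :=
  ∑ P, c P * (P.1 0 ^ a * P.1 1 ^ b)

/-- The pairing with the monomial `X ^ (n / 3) * Y ^ (n % 3)` of code `n`. -/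
noncomputable def syndrome (c : Points (kleinIdeal F) → F) (n : ℕ) : F := pairing c (n / 3) (n % 3)

theorem pairing_y_cubed [CharP F 2] (c : Points (kleinIdeal F) → F) (a b : ℕ) :
    pairing c a (b + 3) = pairing c (a + 3) (b + 1) + pairing c (a + 1) b := by
  have h2 : (2 : F) = 0 := CharTwo.two_eq_zero
  rw [pairing, pairing, pairing, ← Finset.sum_add_distrib]
  refine Finset.sum_congr rfl fun P _ => ?_
  linear_combination c P * P.1 0 ^ a * P.1 1 ^ b * P.curve_eq -
    c P * P.1 0 ^ a * P.1 1 ^ b * (P.1 0 ^ 3 * P.1 1 + P.1 0) * h2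

theorem pairing_x_pow (hF : Nat.card F = 8) (c : Points (kleinIdeal F) → F) (a b : ℕ) :
    pairing c (a + 8) b = pairing c (a + 1) b := by
  refine Finset.sum_congr rfl fun P _ => ?_
  rw [pow_add, pow_eight_of_card_eq_eight hF, ← pow_succ]

theorem Points.x_pow_seven_mul_y (hF : Nat.card F = 8) (P : Points (kleinIdeal F)) :
    P.1 0 ^ 7 * P.1 1 = P.1 1 := by
  rcases eq_or_ne (P.1 0) 0 with h | h
  · have := P.curve_eq
    have hy : P.1 1 = 0 := pow_eq_zero_iff (three_ne_zero) |>.1 (by simpa [h] using this)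
    rw [hy, mul_zero]
  · have h8 := pow_eight_of_card_eq_eight hF (P.1 0)
    have h7 : P.1 0 ^ 7 = 1 := mul_right_cancel₀ h (by rw [← pow_succ, h8, one_mul])
    rw [h7, one_mul]

theorem pairing_x_pow_mul_y (hF : Nat.card F = 8) (c : Points (kleinIdeal F) → F) (a b : ℕ) :
    pairing c (a + 7) (b + 1) = pairing c a (b + 1) := by
  refine Finset.sum_congr rfl fun P _ => ?_
  linear_combination c P * P.1 0 ^ a * P.1 1 ^ b * P.x_pow_seven_mul_y hF

/-- The code of the monomial to which `X ^ a * Y ^ b` with `b < 3` reduces. -/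
def reducedCode (a b : ℕ) : ℕ :=
  if b = 0 then (if a < 8 then 3 * a else 3 * ((a - 1) % 7 + 1)) else 3 * (a % 7) + b

/-- The codes of the monomials in the normal form of `X ^ a * Y ^ b`, where `b < 5`. -/
def normalForm (a b : ℕ) : List ℕ :=
  if b < 3 then [reducedCode a b] else [reducedCode (a + 3) (b - 2), reducedCode (a + 1) (b - 3)]

theorem pairing_eq_syndrome_reducedCode (hF : Nat.card F = 8) (c : Points (kleinIdeal F) → F)
    (a b : ℕ) (hb : b < 3) : pairing c a b = syndrome c (reducedCode a b) := by
  have key : ∀ n : ℕ, ∀ i j : ℕ, n = 3 * i + j → j < 3 → pairing c i j = syndrome c n := by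
    rintro _ i j rfl hj
    rw [syndrome, show (3 * i + j) / 3 = i by omega, show (3 * i + j) % 3 = j by omega]
  induction a using Nat.strong_induction_on with
  | _ a ih =>
    by_cases hb0 : b = 0
    · subst hb0
      by_cases ha : a < 8
      · exact key _ a 0 (by simp [reducedCode, ha]) hb
      · obtain ⟨k, rfl⟩ : ∃ k, a = k + 8 := ⟨a - 8, by omega⟩
        rw [pairing_x_pow hF, ih (k + 1) (by omega)]
        congr 1
        simp only [reducedCode]
        split_ifs <;> omega
    · by_cases ha : a < 7
      · exact key _ a b (by rw [reducedCode, if_neg hb0, Nat.mod_eq_of_lt ha]) hb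
      · obtain ⟨k, rfl⟩ : ∃ k, a = k + 7 := ⟨a - 7, by omega⟩
        obtain ⟨j, rfl⟩ : ∃ j, b = j + 1 := ⟨b - 1, by omega⟩
        rw [pairing_x_pow_mul_y hF, ih k (by omega)]
        congr 1
        simp [reducedCode]

theorem pairing_eq_sum_normalForm (hF : Nat.card F = 8) (c : Points (kleinIdeal F) → F)
    (a b : ℕ) (hb : b < 5) : pairing c a b = ((normalForm a b).map (syndrome c)).sum := by
  have := charP_two_of_card_eq_eight hF
  rw [normalForm]
  split_ifs with h
  · simp [pairing_eq_syndrome_reducedCode hF c a b h]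
  · obtain ⟨j, rfl⟩ : ∃ j, b = j + 3 := ⟨b - 3, by omega⟩
    simp [pairing_y_cubed, pairing_eq_syndrome_reducedCode hF c (a + 3) (j + 1) (by omega),
      pairing_eq_syndrome_reducedCode hF c (a + 1) j (by omega)]

/-- The normal form of the product of two monomials, given by their codes. -/
def mulNormalForm (m n : ℕ) : List ℕ := normalForm (m / 3 + n / 3) (m % 3 + n % 3)

/-- The value at `P` of the monomial of code `n`. -/
noncomputable def monoVal (n : ℕ) (P : Points (kleinIdeal F)) : F :=
  P.1 0 ^ (n / 3) * P.1 1 ^ (n % 3)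

theorem sum_mul_monoVal (hF : Nat.card F = 8) (c : Points (kleinIdeal F) → F) (m n : ℕ) :
    ∑ P, c P * (monoVal m P * monoVal n P) = ((mulNormalForm m n).map (syndrome c)).sum := by
  rw [mulNormalForm, ← pairing_eq_sum_normalForm hF _ _ _ (by omega), pairing]
  refine Finset.sum_congr rfl fun P _ => ?_
  rw [monoVal, monoVal]
  ring

end Pairing

/-! ### Certificates for lower bounds on the weight -/

/-- A proof tree for a lower bound on the weight of a word. A leaf lists pairs of monomials whose
syndromes form a triangular matrix; an inner node distinguishes whether a given syndrome
vanishes. -/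
inductive WeightCert
  | leaf (l : List (ℕ × ℕ))
  | split (j : ℕ) (ne eq : WeightCert)

/-- All terms of the product have vanishing syndrome. -/
def vanishes (Z : List ℕ) (m n : ℕ) : Bool := (mulNormalForm m n).all fun k => Z.contains k

/-- Exactly one term of the product is not known to have vanishing syndrome, and it is known to
have a nonvanishing one. -/
def survives (Z N : List ℕ) (m n : ℕ) : Bool :=
  match (mulNormalForm m n).filter fun k => !Z.contains k with
  | [k] => N.contains k
  | _ => false

/-- Validity of a certificate for the weight `w`, if the syndromes in `Z` vanish and those in `N`
do not. -/
def WeightCert.check (w : ℕ) : WeightCert → List ℕ → List ℕ → Bool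
  | leaf l, Z, N => l.length == w && (l.all fun u => survives Z N u.1 u.2) &&
      decide (l.Pairwise fun u v => vanishes Z u.1 v.2 = true)
  | split j s t, Z, N => s.check w Z (j :: N) && t.check w (j :: Z) N

section Soundness

variable {F : Type*} [Field F] [Finite F]

theorem sum_eq_zero_of_vanishes (hF : Nat.card F = 8) {c : Points (kleinIdeal F) → F} {Z : List ℕ}
    (hZ : ∀ j ∈ Z, syndrome c j = 0) {m n : ℕ} (h : vanishes Z m n = true) :
    ∑ P, c P * (monoVal m P * monoVal n P) = 0 := by
  rw [sum_mul_monoVal hF]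
  refine List.sum_eq_zero fun x hx => ?_
  obtain ⟨k, hk, rfl⟩ := List.mem_map.1 hx
  exact hZ k (by simpa using List.all_eq_true.1 h k hk)

theorem List.sum_map_eq_sum_map_filter {α M : Type*} [AddCommMonoid M] (f : α → M) (p : α → Bool)
    (l : List α) (h : ∀ a ∈ l, p a = false → f a = 0) :
    (l.map f).sum = ((l.filter p).map f).sum := by
  induction l with
  | nil => rfl
  | cons a l ih =>
    have ih := ih fun b hb => h b (List.mem_cons_of_mem a hb)
    cases hp : p a
    · rw [List.filter_cons_of_neg (by simp [hp]), ← ih, List.map_cons, List.sum_cons,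
        h a List.mem_cons_self hp, zero_add]
    · rw [List.filter_cons_of_pos hp, List.map_cons, List.map_cons, List.sum_cons, List.sum_cons,
        ih]

theorem sum_ne_zero_of_survives (hF : Nat.card F = 8) {c : Points (kleinIdeal F) → F}
    {Z N : List ℕ} (hZ : ∀ j ∈ Z, syndrome c j = 0) (hN : ∀ j ∈ N, syndrome c j ≠ 0) {m n : ℕ}
    (h : survives Z N m n = true) : ∑ P, c P * (monoVal m P * monoVal n P) ≠ 0 := by
  rw [sum_mul_monoVal hF, List.sum_map_eq_sum_map_filter _ (fun k => !Z.contains k) _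
    fun k _ hk => hZ k (by simpa using hk)]
  rw [survives] at h
  split at h
  next k hk =>
    rw [hk]
    simpa using hN k (by simpa using h)
  · exact absurd h Bool.false_ne_true

theorem WeightCert.le_weight (hF : Nat.card F = 8) {c : Points (kleinIdeal F) → F} {w : ℕ}
    (t : WeightCert) {Z N : List ℕ} (ht : t.check w Z N = true)
    (hZ : ∀ j ∈ Z, syndrome c j = 0) (hN : ∀ j ∈ N, syndrome c j ≠ 0) : w ≤ weight c := by
  induction t generalizing Z N with
  | leaf l =>
    simp only [check, Bool.and_eq_true, beq_iff_eq, decide_eq_true_eq, List.all_eq_true] at ht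
    obtain ⟨⟨rfl, hdiag⟩, hpair⟩ := ht
    refine le_weight_of_triangular c (fun u => monoVal (l.get u).1) (fun u => monoVal (l.get u).2)
      (fun u => ?_) (fun u v huv => ?_)
    · exact sum_ne_zero_of_survives hF hZ hN (hdiag _ (List.get_mem l u))
    · exact sum_eq_zero_of_vanishes hF hZ (List.pairwise_iff_get.1 hpair u v huv)
  | split j s t hs ht' =>
    simp only [check, Bool.and_eq_true] at ht
    by_cases hj : syndrome c j = 0
    · exact ht' ht.2 (List.forall_mem_cons.2 ⟨hj, hZ⟩) hN
    · exact hs ht.1 hZ (List.forall_mem_cons.2 ⟨hj, hN⟩)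

end Soundness

/-! ### The footprint -/

/-- The exponent of the monomial of code `n`. -/
noncomputable def expo (n : ℕ) : Fin 2 →₀ ℕ := Finsupp.single 0 (n / 3) + Finsupp.single 1 (n % 3)

@[simp] theorem expo_zero (n : ℕ) : expo n 0 = n / 3 := by simp [expo]

@[simp] theorem expo_one (n : ℕ) : expo n 1 = n % 3 := by simp [expo]

theorem expo_injective : Function.Injective expo := fun m n h => by
  have h0 := DFunLike.congr_fun h 0
  have h1 := DFunLike.congr_fun h 1
  simp only [expo_zero, expo_one] at h0 h1
  omega

theorem notMem_footprint_of_degree_le {F : Type*} [Field F] {J : Ideal (MvPolynomial (Fin 2) F)}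
    {f : MvPolynomial (Fin 2) F} (hf : f ∈ J) (hf0 : f ≠ 0) {a : Fin 2 →₀ ℕ}
    (ha : wOrder.degree f ≤ a) : a ∉ footprint wOrder J := by
  classical
  intro h
  have hm : (monomial (a - wOrder.degree f) (1 : F)) ≠ 0 := by simp
  refine h (monomial (a - wOrder.degree f) 1 * f) (J.mul_mem_left _ hf) (mul_ne_zero hm hf0) ?_
  rw [wOrder.degree_mul hm hf0, wOrder.degree_monomial, if_neg one_ne_zero,
    tsub_add_cancel_of_le ha]

theorem degree_X_pow_mul_X_pow {F : Type*} [Field F] (i j : ℕ) :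
    wOrder.degree (X 0 ^ i * X 1 ^ j : MvPolynomial (Fin 2) F) =
      Finsupp.single 0 i + Finsupp.single 1 j := by
  rw [wOrder.degree_mul (pow_ne_zero _ (X_ne_zero _)) (pow_ne_zero _ (X_ne_zero _)),
    wOrder.degree_pow, wOrder.degree_pow, wOrder.degree_X, wOrder.degree_X]
  simp

theorem curve_mem {F : Type*} [Field F] : (X 1 ^ 3 + X 0 ^ 3 * X 1 + X 0 : MvPolynomial (Fin 2) F) ∈
    fieldIdeal (kleinIdeal F) :=
  Ideal.mem_sup_left (Ideal.subset_span (Set.mem_singleton _))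

theorem field_equation_mem {F : Type*} [Field F] (hF : Nat.card F = 8) (i : Fin 2) :
    (X i ^ 8 - X i : MvPolynomial (Fin 2) F) ∈ fieldIdeal (kleinIdeal F) :=
  Ideal.mem_sup_right (Ideal.subset_span ⟨i, by rw [hF]⟩)

theorem notMem_footprint_of_binomial {F : Type*} [Field F]
    {J : Ideal (MvPolynomial (Fin 2) F)}
    {i j : ℕ} {g : MvPolynomial (Fin 2) F} (hf : X 0 ^ i * X 1 ^ j + g ∈ J)
    (hlt : wOrder.degree g ≺[wOrder] Finsupp.single 0 i + Finsupp.single 1 j) {a : Fin 2 →₀ ℕ}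
    (hi : i ≤ a 0) (hj : j ≤ a 1) : a ∉ footprint wOrder J := by
  rw [← degree_X_pow_mul_X_pow (F := F)] at hlt
  have hdeg := wOrder.degree_add_of_lt hlt
  have hpos : X 0 ^ i * X 1 ^ j + g ≠ 0 := by
    intro h0
    rw [h0, wOrder.degree_zero, degree_X_pow_mul_X_pow] at hdeg
    rw [degree_X_pow_mul_X_pow, ← hdeg] at hlt
    exact absurd hlt (not_lt_of_ge (wOrder.zero_le _))
  refine notMem_footprint_of_degree_le hf hpos ?_
  rw [hdeg, degree_X_pow_mul_X_pow]
  intro k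
  fin_cases k <;> simpa

section Footprint

variable {F : Type*} [Field F] [Finite F]

theorem dotProduct_ev_monomial (c : Points (kleinIdeal F) → F) (v : Fin 2 →₀ ℕ) (r : F) :
    c ⬝ᵥ ev (kleinIdeal F) (monomial v r) = r * pairing c (v 0) (v 1) := by
  rw [dotProduct, pairing, Finset.mul_sum]
  refine Finset.sum_congr rfl fun P _ => ?_
  have : ev (kleinIdeal F) (monomial v r) P = r * (P.1 0 ^ v 0 * P.1 1 ^ v 1) := by
    show aeval (R := F) P.1 (monomial v r) = _
    rw [aeval_monomial, Finsupp.prod_fintype _ _ fun i => pow_zero _, Fin.prod_univ_two]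
    rfl
  rw [this]
  ring

theorem dotProduct_ev (c : Points (kleinIdeal F) → F) (f : MvPolynomial (Fin 2) F) :
    c ⬝ᵥ ev (kleinIdeal F) f = ∑ v ∈ f.support, f.coeff v * pairing c (v 0) (v 1) := by
  conv_lhs => rw [f.as_sum]
  rw [map_sum, dotProduct_sum]
  exact Finset.sum_congr rfl fun v _ => dotProduct_ev_monomial c v _

/-- Every monomial reduces to monomials of code less than `22` that do not exceed it. -/
theorem pairing_eq_zero_of_syndrome (hF : Nat.card F = 8) (c : Points (kleinIdeal F) → F)
    (a b : ℕ) (h : ∀ k < 22, (2 * (k / 3) + 3 * (k % 3) < 2 * a + 3 * b ∨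
      (2 * (k / 3) + 3 * (k % 3) = 2 * a + 3 * b ∧ k % 3 ≤ b)) → syndrome c k = 0) :
    pairing c a b = 0 := by
  have := charP_two_of_card_eq_eight hF
  induction hn : a + 2 * b using Nat.strong_induction_on generalizing a b with
  | _ n ih =>
    subst hn
    by_cases hb : b < 3
    · by_cases hk : 3 * a + b < 22
      · have := h (3 * a + b) hk (by omega)
        rwa [syndrome, show (3 * a + b) / 3 = a by omega, show (3 * a + b) % 3 = b by omega] at this
      · by_cases hb0 : b = 0
        · subst hb0
          obtain ⟨i, rfl⟩ : ∃ i, a = i + 8 := ⟨a - 8, by omega⟩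
          rw [pairing_x_pow hF]
          exact ih _ (by omega) (i + 1) 0 (fun k hk hle => h k hk (by omega)) rfl
        · obtain ⟨i, rfl⟩ : ∃ i, a = i + 7 := ⟨a - 7, by omega⟩
          obtain ⟨j, rfl⟩ : ∃ j, b = j + 1 := ⟨b - 1, by omega⟩
          rw [pairing_x_pow_mul_y hF]
          exact ih _ (by omega) i (j + 1) (fun k hk hle => h k hk (by omega)) rfl
    · obtain ⟨j, rfl⟩ : ∃ j, b = j + 3 := ⟨b - 3, by omega⟩
      rw [pairing_y_cubed, ih _ (by omega) (a + 3) (j + 1) (fun k hk hle => h k hk (by omega)) rfl,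
        ih _ (by omega) (a + 1) j (fun k hk hle => h k hk (by omega)) rfl, add_zero]

theorem eq_zero_of_syndrome_eq_zero (hF : Nat.card F = 8) (c : Points (kleinIdeal F) → F)
    (h : ∀ k < 22, syndrome c k = 0) : c = 0 := by
  classical
  have := Fintype.ofFinite F
  funext P
  have h0 : c ⬝ᵥ ev (kleinIdeal F) (indicator P.1) = 0 := by
    rw [dotProduct_ev]
    exact Finset.sum_eq_zero fun v _ => by
      rw [pairing_eq_zero_of_syndrome hF c _ _ fun k hk _ => h k hk, mul_zero]
  have hev : ∀ Q, ev (kleinIdeal F) (indicator P.1) Q = eval Q.1 (indicator P.1) := fun Q => by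
    rw [← aeval_eq_eval]; rfl
  rw [dotProduct, Finset.sum_eq_single P] at h0
  · rwa [hev, eval_indicator_apply_eq_one, mul_one] at h0
  · intro Q _ hQ
    rw [hev, eval_indicator_apply_eq_zero _ _ fun h => hQ (Subtype.ext h), mul_zero]
  · exact fun h => absurd (Finset.mem_univ P) h

/-- The evaluations of the `22` monomials of code less than `22` have a dual basis. -/
theorem exists_dual_word (hF : Nat.card F = 8) {n : ℕ} (hn : n < 22) :
    ∃ c : Points (kleinIdeal F) → F, syndrome c n = 1 ∧ ∀ k < 22, k ≠ n → syndrome c k = 0 := by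
  have := charP_two_of_card_eq_eight hF
  obtain ⟨α, hα⟩ := exists_cubic_root hF
  obtain ⟨φ, -⟩ := GF8.exists_ringEquiv hF α hα
  let T : (Points (kleinIdeal F) → F) →ₗ[F] (Fin 22 → F) :=
    { toFun := fun c k => syndrome c k
      map_add' := fun c d => by
        funext k
        simp only [syndrome, pairing, Pi.add_apply, add_mul, Finset.sum_add_distrib]
      map_smul' := fun r c => by
        funext k
        simp only [syndrome, pairing, Pi.smul_apply, smul_eq_mul, Finset.mul_sum, mul_assoc,
          RingHom.id_apply] }
  have hinj : Function.Injective T := by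
    rw [injective_iff_map_eq_zero]
    exact fun c hc => eq_zero_of_syndrome_eq_zero hF c fun k hk => congrFun hc ⟨k, hk⟩
  have hsurj : Function.Surjective T :=
    (LinearMap.injective_iff_surjective_of_finrank_eq_finrank (by simp [card_points φ])).1 hinj
  obtain ⟨c, hc⟩ := hsurj (Pi.single ⟨n, hn⟩ 1)
  refine ⟨c, (congrFun hc ⟨n, hn⟩).trans (Pi.single_eq_same _ _), fun k hk hkn => ?_⟩
  exact (congrFun hc ⟨k, hk⟩).trans (Pi.single_eq_of_ne (fun h => hkn (congrArg Fin.val h)) _)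

theorem x_pow_seven_mul_y_sub_y_mem (hF : Nat.card F = 8) :
    (X 0 ^ 7 * X 1 - X 1 : MvPolynomial (Fin 2) F) ∈ fieldIdeal (kleinIdeal F) := by
  have := charP_two_of_card_eq_eight hF
  have h2 : (2 : MvPolynomial (Fin 2) F) = 0 := CharTwo.two_eq_zero
  have hG := curve_mem (F := F)
  have h : (X 0 ^ 7 * X 1 - X 1 : MvPolynomial (Fin 2) F) = (X 1 ^ 8 - X 1)
      - (X 1 ^ 2 * (X 1 ^ 3 + X 0 ^ 3 * X 1 + X 0) + X 0 ^ 6 * X 1) *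
        (X 1 ^ 3 + X 0 ^ 3 * X 1 + X 0)
      - X 0 * X 1 ^ 2 * (X 0 ^ 8 - X 0) := by
    linear_combination (X 0 ^ 6 * X 1 ^ 4 + X 0 ^ 3 * X 1 ^ 6 + X 0 * X 1 ^ 5 + X 0 ^ 4 * X 1 ^ 3
      + X 0 ^ 9 * X 1 ^ 2 + X 0 ^ 7 * X 1) * h2
  rw [h]
  exact sub_mem (sub_mem (field_equation_mem hF 1) (Ideal.mul_mem_left _ _ hG))
    (Ideal.mul_mem_left _ _ (field_equation_mem hF 0))

theorem mem_footprint_iff (hF : Nat.card F = 8) (a : Fin 2 →₀ ℕ) :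
    a ∈ footprint wOrder (fieldIdeal (kleinIdeal F)) ↔ ∃ n < 22, expo n = a := by
  constructor
  · intro ha
    have h1 : a 1 < 3 := by
      by_contra h
      refine notMem_footprint_of_binomial (i := 0) (j := 3)
        (g := X 0 ^ 3 * X 1 ^ 1 + X 0 ^ 1 * X 1 ^ 0) ?_ ?_ (Nat.zero_le _) (not_lt.1 h) ha
      · simpa [add_assoc] using curve_mem (F := F)
      · rw [wOrder.degree_add_of_lt] <;>
          · simp only [degree_X_pow_mul_X_pow, wOrder_lt_iff]
            simp
    have h2 : a 1 = 0 → a 0 < 8 := fun _ => by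
      by_contra h
      refine notMem_footprint_of_binomial (i := 8) (j := 0) (g := - (X 0 ^ 1 * X 1 ^ 0)) ?_ ?_
        (not_lt.1 h) (Nat.zero_le _) ha
      · simpa [sub_eq_add_neg] using field_equation_mem hF 0
      · rw [wOrder.degree_neg]
        simp only [degree_X_pow_mul_X_pow, wOrder_lt_iff]
        simp
    have h3 : 1 ≤ a 1 → a 0 < 7 := fun h1 => by
      by_contra h
      refine notMem_footprint_of_binomial (i := 7) (j := 1) (g := - (X 0 ^ 0 * X 1 ^ 1)) ?_ ?_
        (not_lt.1 h) h1 ha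
      · simpa [sub_eq_add_neg] using x_pow_seven_mul_y_sub_y_mem hF
      · rw [wOrder.degree_neg]
        simp only [degree_X_pow_mul_X_pow, wOrder_lt_iff]
        simp
    refine ⟨3 * a 0 + a 1, by omega, Finsupp.ext fun k => ?_⟩
    fin_cases k
    · show expo _ 0 = a 0
      rw [expo_zero]
      omega
    · show expo _ 1 = a 1
      rw [expo_one]
      omega
  · rintro ⟨n, hn, rfl⟩ f hf hf0 hdeg
    obtain ⟨c, hc1, hc0⟩ := exists_dual_word hF hn
    have hev : ev (kleinIdeal F) f = 0 := funext fun P => P.2 f hf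
    have hsum := dotProduct_ev c f
    rw [hev, dotProduct_zero, Finset.sum_eq_single (expo n)] at hsum
    · rw [expo_zero, expo_one] at hsum
      rw [show pairing c (n / 3) (n % 3) = 1 from hc1, mul_one, ← hdeg] at hsum
      exact wOrder.coeff_degree_ne_zero_iff.2 hf0 hsum.symm
    · intro v hv hvn
      have hlt : v ≺[wOrder] expo n :=
        lt_of_le_of_ne (hdeg ▸ wOrder.le_degree hv) fun h => hvn (wOrder.toSyn.injective h)
      rw [wOrder_lt_iff, expo_zero, expo_one] at hlt
      rw [pairing_eq_zero_of_syndrome hF c _ _ fun k hk hle => hc0 k hk (by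
        rintro rfl; omega), mul_zero]
    · intro hns
      exact absurd (hdeg ▸ wOrder.degree_mem_support hf0) hns

/-! ### Membership in the codes `C(s)` -/

/-- A number that orders the codes as `wOrder` orders the monomials. -/
def wKey (n : ℕ) : ℕ := 3 * (2 * (n / 3) + 3 * (n % 3)) + n % 3

/-- The number of predecessors of the monomial of code `n` in the footprint. -/
def codeRank (n : ℕ) : ℕ := ((Finset.range 22).filter fun k => wKey k < wKey n).card

theorem expo_lt_expo_iff (m n : ℕ) : expo m ≺[wOrder] expo n ↔ wKey m < wKey n := by
  rw [wOrder_lt_iff, expo_zero, expo_one, expo_zero, expo_one, wKey, wKey]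
  omega

theorem mem_kleinMonomials_iff (hF : Nat.card F = 8) (s : ℕ) (a : Fin 2 →₀ ℕ) :
    a ∈ kleinMonomials F s ↔ ∃ n < 22, codeRank n < s ∧ expo n = a := by
  have hrank : ∀ n, {b ∈ footprint wOrder (fieldIdeal (kleinIdeal F)) |
      b ≺[wOrder] expo n}.ncard = codeRank n := fun n => by
    have : {b ∈ footprint wOrder (fieldIdeal (kleinIdeal F)) | b ≺[wOrder] expo n} =
        expo '' ((Finset.range 22).filter fun k => wKey k < wKey n : Finset ℕ) := by
      ext b
      simp only [Set.mem_ofPred_eq, mem_footprint_iff hF, Set.mem_image, Finset.coe_filter,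
        Finset.mem_range]
      constructor
      · rintro ⟨⟨k, hk, rfl⟩, hlt⟩
        exact ⟨k, ⟨hk, (expo_lt_expo_iff k n).1 hlt⟩, rfl⟩
      · rintro ⟨k, ⟨hk, hlt⟩, rfl⟩
        exact ⟨⟨k, hk, rfl⟩, (expo_lt_expo_iff k n).2 hlt⟩
    rw [this, Set.ncard_image_of_injective _ expo_injective, Set.ncard_coe_finset, codeRank]
  constructor
  · rintro ⟨hmem, hlt⟩
    obtain ⟨n, hn, rfl⟩ := (mem_footprint_iff hF a).1 hmem
    exact ⟨n, hn, (hrank n) ▸ hlt, rfl⟩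
  · rintro ⟨n, hn, hlt, rfl⟩
    exact ⟨(mem_footprint_iff hF _).2 ⟨n, hn, rfl⟩, (hrank n).symm ▸ hlt⟩

theorem mem_kleinCode_iff (hF : Nat.card F = 8) (s : ℕ) (c : Points (kleinIdeal F) → F) :
    c ∈ kleinCode F s ↔ ∀ n < 22, codeRank n < s → syndrome c n = 0 := by
  have hdot : ∀ n, c ⬝ᵥ ev (kleinIdeal F) (monomial (expo n) 1) = syndrome c n := fun n => by
    rw [dotProduct_ev_monomial, one_mul, expo_zero, expo_one, syndrome]
  rw [kleinCode, dualSeqCode, mem_dualAffineCode_iff]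
  constructor
  · intro h n hn hs
    rw [← hdot]
    exact h _ ((mem_kleinMonomials_iff hF s _).2 ⟨n, hn, hs, rfl⟩)
  · intro h a ha
    obtain ⟨n, hn, hs, rfl⟩ := (mem_kleinMonomials_iff hF s a).1 ha
    rw [hdot]
    exact h n hn hs

end Footprint

/-! ### Lower bounds for the relative distances -/

/-- For each monomial of the footprint from the fourth on: its code `n`, a lower bound for the
weight of the words whose first nonvanishing syndrome is that of `n`, and a certificate. -/
def kleinCerts : List (ℕ × ℕ × WeightCert) := [
  (6, 3, .leaf [(0, 6), (3, 3), (6, 0)]),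
  (4, 3, .leaf [(3, 1), (6, 19), (4, 0)]),
  (9, 3, .leaf [(3, 6), (6, 3), (9, 0)]),
  (2, 3, .leaf [(9, 14), (10, 13), (8, 15)]),
  (7, 6, .leaf [(0, 7), (3, 4), (1, 6), (6, 1), (4, 3), (7, 0)]),
  (12, 6, .split 5 (.leaf [(0, 5), (3, 2), (1, 4), (6, 6), (4, 1), (12, 0)]) (.split 10 (.leaf
    [(9, 3), (7, 17), (12, 21), (8, 16), (15, 18), (18, 15)]) (.split 13 (.leaf [(3, 9), (6,
    6), (9, 3), (5, 1), (12, 0), (15, 19)]) (.split 15 (.leaf [(0, 15), (3, 9), (6, 6), (9, 3),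
    (12, 0), (14, 1)]) (.split 18 (.leaf [(0, 12), (3, 15), (6, 6), (9, 3), (12, 0), (17, 1)])
    (.leaf [(0, 12), (3, 9), (12, 0), (9, 3), (18, 15), (6, 6)])))))),
  (5, 6, .leaf [(0, 5), (3, 2), (1, 4), (4, 1), (2, 3), (5, 0)]),
  (10, 8, .leaf [(0, 10), (3, 7), (1, 9), (6, 4), (4, 6), (9, 1), (7, 3), (10, 0)]),
  (15, 8, .split 8 (.leaf [(15, 14), (18, 18), (16, 13), (0, 8), (19, 10), (3, 12), (1, 7), (6,
    9)]) (.split 13 (.leaf [(0, 13), (3, 10), (1, 5), (20, 7), (6, 9), (4, 2), (2, 4), (9, 6)])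
    (.split 16 (.leaf [(9, 7), (10, 20), (12, 3), (13, 17), (15, 0), (18, 18), (14, 16), (0,
    15)]) (.leaf [(1, 14), (0, 15), (3, 12), (6, 9), (9, 6), (12, 3), (15, 0), (14, 1)])))),
  (8, 9, .leaf [(0, 8), (3, 5), (1, 7), (6, 2), (4, 4), (2, 6), (7, 1), (5, 3), (8, 0)]),
  (13, 11, .split 18 (.split 11 (.split 21 (.leaf [(12, 6), (9, 12), (10, 3), (15, 19), (8,
    13), (7, 14), (6, 15), (5, 16), (3, 18), (0, 21), (13, 0)]) (.split 16 (.split 19 (.split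
    20 (.leaf [(6, 14), (9, 4), (7, 20), (12, 1), (5, 15), (4, 16), (3, 17), (2, 18), (0, 19),
    (10, 3), (13, 0)]) (.leaf [(0, 18), (3, 15), (1, 5), (6, 7), (20, 20), (4, 9), (9, 4), (7,
    6), (12, 1), (10, 3), (13, 21)])) (.split 20 (.leaf [(12, 1), (9, 11), (6, 14), (7, 13),
    (4, 16), (5, 15), (3, 17), (0, 18), (1, 19), (10, 3), (13, 0)]) (.leaf [(18, 21), (0, 11),
    (16, 2), (15, 3), (14, 4), (13, 5), (12, 6), (11, 7), (10, 8), (9, 9), (8, 10)]))) (.split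
    19 (.split 20 (.leaf [(12, 1), (9, 10), (10, 17), (15, 19), (8, 12), (7, 13), (6, 14), (0,
    18), (5, 15), (3, 16), (13, 0)]) (.leaf [(9, 10), (6, 13), (7, 6), (12, 1), (5, 14), (4,
    15), (3, 16), (2, 17), (1, 18), (0, 19), (10, 3)])) (.split 20 (.leaf [(6, 5), (9, 9), (4,
    16), (7, 20), (12, 1), (5, 15), (3, 17), (0, 18), (1, 19), (10, 3), (13, 0)]) (.leaf [(6,
    5), (3, 15), (1, 17), (0, 18), (20, 19), (19, 20), (4, 9), (9, 4), (7, 6), (12, 1), (10,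
    3)]))))) (.leaf [(0, 18), (3, 15), (1, 5), (6, 7), (2, 4), (9, 9), (4, 2), (7, 6), (12, 1),
    (10, 3), (13, 0)])) (.split 21 (.leaf [(6, 7), (3, 18), (4, 2), (9, 4), (2, 19), (1, 20),
    (0, 21), (7, 6), (12, 1), (10, 3), (13, 0)]) (.split 16 (.split 19 (.split 11 (.split 20
    (.leaf [(6, 13), (9, 2), (12, 1), (7, 6), (5, 15), (4, 16), (3, 17), (0, 19), (1, 18), (10,
    3), (13, 21)]) (.leaf [(6, 5), (9, 4), (3, 16), (0, 19), (1, 18), (4, 9), (20, 20), (7, 6),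
    (12, 1), (10, 3), (13, 0)])) (.split 20 (.leaf [(9, 10), (12, 1), (6, 13), (3, 17), (4,
    15), (2, 18), (1, 19), (0, 20), (7, 6), (10, 3), (13, 0)]) (.leaf [(0, 13), (3, 10), (18,
    1), (6, 7), (15, 4), (10, 3), (8, 5), (7, 12), (4, 15), (1, 18), (13, 21)]))) (.leaf [(0,
    13), (18, 19), (15, 1), (3, 10), (6, 7), (9, 4), (19, 15), (1, 12), (4, 9), (7, 6), (10,
    3)])) (.leaf [(12, 1), (15, 19), (18, 16), (0, 13), (3, 10), (16, 18), (1, 12), (7, 6),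
    (13, 21), (19, 15), (4, 9)])))),
  (18, 12, .split 21 (.leaf [(12, 6), (9, 12), (7, 14), (6, 15), (5, 16), (4, 17), (3, 18), (2,
    19), (0, 21), (21, 0), (20, 1), (15, 3)]) (.split 16 (.split 11 (.split 19 (.split 20
    (.leaf [(6, 12), (4, 15), (3, 17), (9, 2), (2, 18), (1, 19), (0, 20), (7, 4), (12, 6), (10,
    1), (15, 3), (18, 21)]) (.leaf [(0, 11), (3, 15), (1, 10), (6, 12), (4, 7), (9, 9), (7, 4),
    (20, 20), (12, 6), (10, 1), (15, 3), (18, 21)])) (.split 20 (.leaf [(3, 15), (0, 18), (1,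
    19), (19, 1), (6, 12), (4, 7), (20, 0), (18, 2), (9, 9), (7, 4), (12, 6), (15, 3)]) (.leaf
    [(6, 5), (9, 7), (7, 4), (4, 14), (3, 15), (2, 16), (1, 17), (0, 18), (20, 19), (19, 20),
    (12, 6), (10, 1)]))) (.leaf [(0, 18), (3, 13), (1, 8), (20, 10), (6, 12), (4, 5), (2, 7),
    (9, 9), (7, 2), (5, 4), (12, 6), (15, 3)])) (.split 19 (.split 11 (.split 20 (.leaf [(0,
    19), (1, 10), (3, 8), (4, 7), (6, 12), (7, 4), (20, 0), (19, 1), (13, 6), (18, 2), (9, 9),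
    (15, 3)]) (.leaf [(12, 20), (9, 10), (7, 11), (6, 13), (5, 14), (4, 15), (3, 16), (2, 17),
    (1, 18), (0, 19), (10, 1), (15, 3)])) (.leaf [(0, 18), (1, 11), (3, 15), (4, 8), (6, 12),
    (7, 5), (9, 9), (10, 2), (12, 6), (15, 3), (11, 1), (18, 0)])) (.leaf [(9, 9), (12, 6),
    (15, 3), (0, 18), (3, 15), (6, 12), (2, 16), (5, 13), (8, 10), (18, 0), (11, 7), (14,
    4)])))),
  (11, 12, .leaf [(0, 11), (3, 8), (1, 10), (6, 5), (4, 7), (9, 2), (2, 9), (7, 4), (5, 6),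
    (10, 1), (8, 3), (11, 0)]),
  (16, 14, .split 21 (.leaf [(0, 21), (21, 0), (3, 13), (19, 2), (18, 3), (17, 4), (16, 5),
    (15, 6), (14, 7), (13, 8), (1, 15), (6, 10), (4, 12), (7, 9)]) (.split 19 (.split 20 (.leaf
    [(12, 7), (9, 10), (15, 1), (10, 9), (8, 12), (7, 13), (6, 14), (5, 15), (4, 16), (3, 17),
    (0, 19), (1, 18), (13, 3), (16, 0)]) (.leaf [(0, 19), (3, 13), (16, 21), (19, 18), (17, 2),
    (15, 4), (13, 6), (14, 5), (12, 7), (10, 9), (8, 8), (1, 15), (6, 10), (4, 12)])) (.leaf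
    [(18, 19), (0, 16), (15, 1), (3, 13), (19, 18), (1, 15), (6, 10), (4, 12), (9, 7), (7, 9),
    (12, 4), (10, 6), (13, 3), (16, 0)]))),
  (21, 15, .leaf [(18, 3), (0, 21), (21, 0), (16, 5), (15, 6), (14, 7), (13, 8), (12, 9), (11,
    10), (10, 11), (9, 12), (8, 13), (6, 15), (5, 16), (3, 18)]),
  (14, 15, .leaf [(3, 11), (6, 8), (4, 10), (9, 5), (7, 7), (12, 2), (5, 9), (10, 4), (15, 20),
    (8, 6), (13, 1), (11, 3), (16, 19), (14, 0), (17, 18)]),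
  (19, 17, .split 20 (.leaf [(15, 5), (12, 8), (13, 6), (18, 1), (11, 9), (10, 10), (9, 11),
    (8, 12), (7, 13), (6, 14), (5, 15), (4, 16), (3, 17), (0, 19), (1, 18), (16, 3), (19, 21)])
    (.leaf [(9, 10), (7, 12), (12, 7), (5, 14), (3, 16), (1, 18), (6, 13), (4, 15), (2, 17),
    (0, 19), (20, 20), (18, 1), (16, 3), (19, 0), (17, 2), (10, 9), (15, 4)])),
  (17, 18, .leaf [(13, 4), (16, 1), (19, 19), (1, 16), (4, 13), (7, 10), (12, 5), (15, 2), (18,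
    20), (0, 17), (3, 14), (6, 11), (8, 9), (11, 6), (14, 3), (17, 21), (20, 18), (2, 15)]),
  (20, 21, .leaf [(0, 20), (3, 17), (1, 19), (6, 14), (4, 16), (9, 11), (2, 18), (7, 13), (12,
    8), (5, 15), (10, 10), (15, 5), (8, 12), (13, 7), (18, 2), (11, 9), (16, 4), (14, 6), (19,
    1), (17, 3), (20, 0)])]

theorem kleinCerts_check : kleinCerts.all (fun e => e.1 < 22 && e.2.2.check e.2.1
    ((List.range 22).filter fun k => codeRank k < codeRank e.1) [e.1]) = true := by
  decide +kernel

theorem codeRank_inj : ∀ m < 22, ∀ n < 22, codeRank m = codeRank n → m = n := by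
  decide +kernel

section LowerBounds

variable {F : Type*} [Field F] [Finite F]

theorem le_weight_of_mem_kleinCerts (hF : Nat.card F = 8) {n w : ℕ} {t : WeightCert}
    (h : (n, w, t) ∈ kleinCerts) {c : Points (kleinIdeal F) → F}
    (hc : c ∈ kleinCode F (codeRank n)) (hc' : c ∉ kleinCode F (codeRank n + 1)) :
    w ≤ weight c := by
  have hcheck := List.all_eq_true.1 kleinCerts_check _ h
  simp only [Bool.and_eq_true, decide_eq_true_eq] at hcheck
  obtain ⟨hn, hcheck⟩ := hcheck
  rw [mem_kleinCode_iff hF] at hc hc'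
  refine t.le_weight hF hcheck (fun j hj => ?_) (fun j hj => ?_)
  · simp only [List.mem_filter, List.mem_range, decide_eq_true_eq] at hj
    exact hc j hj.1 hj.2
  · rw [List.mem_singleton.1 hj]
    intro hzero
    refine hc' fun k hk hkn => ?_
    rcases (Nat.lt_succ_iff.1 hkn).lt_or_eq with hlt | heq
    · exact hc k hk hlt
    · rwa [codeRank_inj k hk n hn heq]

/-- Lower bounds for the distances `d(C(s), C(s + 1))`. -/
def kleinBound (s : ℕ) : ℕ :=
  ([0, 0, 0, 3, 3, 3, 3, 6, 6, 6, 8, 8, 9, 11, 12, 12, 14, 15, 15, 17, 18, 21] : List ℕ).getD s 0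

theorem exists_cert : ∀ s < 22, 3 ≤ s →
    ∃ e ∈ kleinCerts.map fun e => (e.1, e.2.1), codeRank e.1 = s ∧ e.2 = kleinBound s := by
  decide +kernel

theorem kleinBound_le_weight (hF : Nat.card F = 8) {s : ℕ} (hs : s < 22)
    {c : Points (kleinIdeal F) → F} (hc : c ∈ kleinCode F s) (hc' : c ∉ kleinCode F (s + 1)) :
    kleinBound s ≤ weight c := by
  by_cases h3 : 3 ≤ s
  · obtain ⟨e, he, hrank, hbound⟩ := exists_cert s hs h3
    obtain ⟨⟨n, w, t⟩, hmem, rfl⟩ := List.mem_map.1 he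
    rw [← hbound]
    exact le_weight_of_mem_kleinCerts hF hmem (hrank ▸ hc) (hrank ▸ hc')
  · rw [show kleinBound s = 0 by interval_cases s <;> rfl]
    exact Nat.zero_le _

theorem le_weight_of_mem_kleinCode (hF : Nat.card F = 8) {s w : ℕ}
    (hw : ∀ i < 22, s ≤ i → w ≤ kleinBound i) {c : Points (kleinIdeal F) → F}
    (hc : c ∈ kleinCode F s) (hc0 : c ≠ 0) : w ≤ weight c := by
  by_contra hlt
  have hall : ∀ k, s + k ≤ 22 → c ∈ kleinCode F (s + k) := by
    intro k
    induction k with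
    | zero => exact fun _ => hc
    | succ k ih =>
      intro hk
      by_contra hnot
      exact hlt ((hw (s + k) (by omega) (by omega)).trans
        (kleinBound_le_weight hF (by omega) (ih (by omega)) hnot))
  have h22 : ∀ k < 22, codeRank k < 22 := by decide +kernel
  refine hc0 (eq_zero_of_syndrome_eq_zero hF c fun k hk => ?_)
  rcases le_total s 22 with hs | hs
  · exact (mem_kleinCode_iff hF _ c).1 (hall (22 - s) (by omega)) k hk (by have := h22 k hk; omega)
  · exact (mem_kleinCode_iff hF _ c).1 hc k hk ((h22 k hk).trans_le hs)

end LowerBounds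

/-! ### Explicit words -/

instance : Nontrivial GF8 := ⟨0, 1, by decide +kernel⟩

instance : NoZeroDivisors GF8 := ⟨fun {a b} h =>
  (by decide +kernel : ∀ a b : GF8, a * b = 0 → a = 0 ∨ b = 0) a b h⟩

/-- The word of values of `g` at the affine points lies in `C(i - 1) \ C(i)` and has weight `w`. -/
def IsGF8Word (g : GF8 → GF8 → GF8) (i w : ℕ) : Prop :=
  (∀ n < 22, codeRank n < i - 1 →
    ∑ p ∈ kleinPoints, g p.1 p.2 * (p.1 ^ (n / 3) * p.2 ^ (n % 3)) = 0) ∧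
  (∃ n < 22, codeRank n < i ∧
    ∑ p ∈ kleinPoints, g p.1 p.2 * (p.1 ^ (n / 3) * p.2 ^ (n % 3)) ≠ 0) ∧
  (kleinPoints.filter fun p => g p.1 p.2 ≠ 0).card = w

instance (g : GF8 → GF8 → GF8) (i w : ℕ) : Decidable (IsGF8Word g i w) :=
  inferInstanceAs (Decidable (_ ∧ _ ∧ _))

theorem isGF8Word_cubic : IsGF8Word (fun x y => GF8.gen * x ^ 3 * y + GF8.gen * x * y ^ 2 +
    (GF8.gen ^ 2 + GF8.gen + 1) * y ^ 2 + (GF8.gen ^ 2 + GF8.gen + 1) * x * y +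
    (GF8.gen + 1) * y + x) 15 12 := by
  decide +kernel

theorem isGF8Word_binomial : IsGF8Word (fun x y => GF8.gen * x ^ 2 * y + 1) 18 15 := by
  decide +kernel

/-- The three `X`-coordinates, all fibres over which avoid the line `X + Y + α`. -/
def avoidingFibres : Finset GF8 := {GF8.gen, GF8.gen ^ 2 + GF8.gen, GF8.gen ^ 2 + GF8.gen + 1}

theorem isGF8Word_line : ∀ B ∈ avoidingFibres.powerset,
    ∀ e ∈ ([(3, 11, 8), (2, 14, 11), (1, 17, 14), (0, 20, 17)] : List (ℕ × ℕ × ℕ)), B.card = e.1 →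
      IsGF8Word (fun x y => y * (x + y + GF8.gen) * ∏ b ∈ B, (x - b)) e.2.1 e.2.2 := by
  decide +kernel

/-- The pairs `(k, i)` such that `ev (Y * g(X))` lies in `C(i - 1) \ C(i)` for `g` of degree `k`. -/
def verticalLevels : List (ℕ × ℕ) := [(6, 7), (5, 10), (4, 13), (3, 16), (2, 19), (1, 21), (0, 22)]

theorem verticalLevels_vanishes : ∀ e ∈ verticalLevels, ∀ m < e.1 + 1, ∀ n < 22,
    codeRank n < e.2 - 1 → vanishes (List.range 21) (3 * m + 1) n = true := by
  decide +kernel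

theorem verticalLevels_survives : ∀ e ∈ verticalLevels, ∃ n < 22, codeRank n < e.2 ∧
    survives (List.range 21) [21] (3 * e.1 + 1) n = true ∧
      ∀ m < e.1, vanishes (List.range 21) (3 * m + 1) n = true := by
  decide +kernel

theorem card_kleinPoints_fibre : ∀ x : GF8, x ≠ 0 →
    (kleinPoints.filter fun p => p.2 ≠ 0 ∧ p.1 = x).card = 3 := by
  decide +kernel

theorem fst_ne_zero_of_mem_kleinPoints : ∀ p ∈ kleinPoints, p.2 ≠ 0 → p.1 ≠ 0 := by
  decide +kernel

theorem card_filter_vertical (B : Finset GF8) (hB : 0 ∉ B) :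
    (kleinPoints.filter fun p => p.2 * ∏ b ∈ B, (p.1 - b) ≠ 0).card = 3 * (7 - B.card) := by
  have hcond : ∀ p : GF8 × GF8, p.2 * ∏ b ∈ B, (p.1 - b) ≠ 0 ↔ p.2 ≠ 0 ∧ p.1 ∉ B := fun p => by
    rw [mul_ne_zero_iff, Finset.prod_ne_zero_iff]
    simp only [ne_eq, sub_eq_zero]
    exact and_congr_right fun _ => ⟨fun h hp => h _ hp rfl, fun h b hb hpb => h (hpb ▸ hb)⟩
  simp only [hcond]
  rw [Finset.card_eq_sum_card_fiberwise (f := Prod.fst) (t := (insert 0 B)ᶜ),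
    Finset.sum_const_nat (m := 3), Finset.card_compl, Finset.card_insert_of_notMem hB, GF8.card_eq,
    mul_comm]
  · congr 1
    omega
  · intro x hx
    simp only [Finset.mem_compl, Finset.mem_insert, not_or] at hx
    rw [← card_kleinPoints_fibre x hx.1, Finset.filter_filter]
    congr 1
    refine Finset.filter_congr fun p _ => ?_
    constructor
    · rintro ⟨⟨h1, -⟩, h2⟩
      exact ⟨h1, h2⟩
    · rintro ⟨h1, rfl⟩
      exact ⟨⟨h1, hx.2⟩, rfl⟩
  · intro p hp
    simp only [Finset.coe_filter, Set.mem_ofPred_eq] at hp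
    simp only [Finset.coe_compl, Set.mem_compl_iff, Finset.mem_coe, Finset.mem_insert, not_or]
    exact ⟨fst_ne_zero_of_mem_kleinPoints p hp.1 hp.2.1, hp.2.2⟩

theorem sum_kleinPoints_monomial : (∀ n < 21,
    ∑ p ∈ kleinPoints, p.1 ^ (n / 3) * p.2 ^ (n % 3) = 0) ∧
      ∑ p ∈ kleinPoints, p.1 ^ 7 * p.2 ^ 0 ≠ 0 := by
  decide +kernel

theorem exists_eq_map {F : Type*} [Field F] (φ : GF8 ≃+* F) (A : Finset F) :
    ∃ B : Finset GF8, A = B.map φ.toEquiv.toEmbedding :=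
  ⟨A.map φ.symm.toEquiv.toEmbedding, by
    ext a
    simp⟩

section Words

variable {F : Type*} [Field F] [Finite F]

theorem isKleinWord_of_syndrome (hF : Nat.card F = 8) {f : MvPolynomial (Fin 2) F} {i w : ℕ}
    (h0 : ∀ n < 22, codeRank n < i - 1 → syndrome (ev (kleinIdeal F) f) n = 0)
    (h1 : ∃ n < 22, codeRank n < i ∧ syndrome (ev (kleinIdeal F) f) n ≠ 0)
    (hw : weight (ev (kleinIdeal F) f) = w) : IsKleinWord f i w := by
  refine ⟨(mem_kleinCode_iff hF _ _).2 h0, fun h => ?_, hw⟩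
  obtain ⟨n, hn, hni, hne⟩ := h1
  exact hne ((mem_kleinCode_iff hF _ _).1 h n hn hni)

theorem syndrome_ev (φ : GF8 ≃+* F) (f : MvPolynomial (Fin 2) F) (g : GF8 → GF8 → GF8)
    (hfg : ∀ x y, aeval (R := F) ![φ x, φ y] f = φ (g x y)) (n : ℕ) :
    syndrome (ev (kleinIdeal F) f) n =
      φ (∑ p ∈ kleinPoints, g p.1 p.2 * (p.1 ^ (n / 3) * p.2 ^ (n % 3))) := by
  have h := sum_points φ fun x y => aeval (R := F) ![x, y] f * (x ^ (n / 3) * y ^ (n % 3))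
  simp only [hfg, ← map_pow, ← map_mul, ← map_sum] at h
  rw [← h, syndrome, pairing]
  refine Finset.sum_congr rfl fun P _ => ?_
  have hP : ![P.1 0, P.1 1] = P.1 := by
    funext k
    fin_cases k <;> rfl
  rw [hP]
  rfl

theorem isKleinWord_of_isGF8Word (hF : Nat.card F = 8) (φ : GF8 ≃+* F)
    {f : MvPolynomial (Fin 2) F} {g : GF8 → GF8 → GF8}
    (hfg : ∀ x y, aeval (R := F) ![φ x, φ y] f = φ (g x y)) {i w : ℕ} (h : IsGF8Word g i w) :
    IsKleinWord f i w := by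
  obtain ⟨h0, ⟨n, hn, hni, hne⟩, hw⟩ := h
  refine isKleinWord_of_syndrome hF (fun k hk hki => ?_) ⟨n, hn, hni, ?_⟩ (weight_ev φ f g hfg ▸ hw)
  · rw [syndrome_ev φ f g hfg, h0 k hk hki, map_zero]
  · rw [syndrome_ev φ f g hfg]
    exact (map_ne_zero_iff φ φ.injective).2 hne

theorem isKleinWord_cubic (hF : Nat.card F = 8) (φ : GF8 ≃+* F) : IsKleinWord
    (C (φ GF8.gen) * X 0 ^ 3 * X 1 + C (φ GF8.gen) * X 0 * X 1 ^ 2 +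
      C (φ GF8.gen ^ 2 + φ GF8.gen + 1) * X 1 ^ 2 +
      C (φ GF8.gen ^ 2 + φ GF8.gen + 1) * X 0 * X 1 + C (φ GF8.gen + 1) * X 1 + X 0) 15 12 :=
  isKleinWord_of_isGF8Word hF φ (fun x y => by simp) isGF8Word_cubic

theorem isKleinWord_binomial (hF : Nat.card F = 8) (φ : GF8 ≃+* F) :
    IsKleinWord (C (φ GF8.gen) * X 0 ^ 2 * X 1 + 1) 18 15 :=
  isKleinWord_of_isGF8Word hF φ (fun x y => by simp) isGF8Word_binomial

theorem isKleinWord_line (hF : Nat.card F = 8) (φ : GF8 ≃+* F) (A : Finset F)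
    (hA : ∀ a ∈ A, a = φ GF8.gen ∨ a = φ GF8.gen ^ 2 + φ GF8.gen ∨
      a = φ GF8.gen ^ 2 + φ GF8.gen + 1) (i w : ℕ)
    (h : (A.card, i, w) ∈ ([(3, 11, 8), (2, 14, 11), (1, 17, 14), (0, 20, 17)] :
      List (ℕ × ℕ × ℕ))) :
    IsKleinWord (X 1 * (X 0 + X 1 + C (φ GF8.gen)) * ∏ a ∈ A, (X 0 - C a)) i w := by
  obtain ⟨B, rfl⟩ := exists_eq_map φ A
  rw [Finset.card_map] at h
  have hB : B ⊆ avoidingFibres := fun b hb => by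
    have := hA (φ b) (Finset.mem_map.2 ⟨b, hb, rfl⟩)
    rw [← map_pow, ← map_add, ← map_one φ, ← map_add, φ.injective.eq_iff, φ.injective.eq_iff,
      φ.injective.eq_iff] at this
    simpa [avoidingFibres] using this
  refine isKleinWord_of_isGF8Word hF φ (fun x y => ?_)
    (isGF8Word_line B (Finset.mem_powerset.2 hB) _ h rfl)
  simp [Finset.prod_map]

theorem syndrome_one_eq_zero (φ : GF8 ≃+* F) : ∀ j ∈ List.range 21,
    syndrome (1 : Points (kleinIdeal F) → F) j = 0 := fun j hj => by
  have h := syndrome_ev φ 1 (fun _ _ => 1) (fun x y => by simp) j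
  have h1 : ev (kleinIdeal F) 1 = 1 := funext fun P => map_one (aeval (R := F) P.1)
  simp only [one_mul] at h
  rw [h1, sum_kleinPoints_monomial.1 j (List.mem_range.1 hj), map_zero] at h
  exact h

theorem syndrome_one_ne_zero (φ : GF8 ≃+* F) : ∀ j ∈ [21],
    syndrome (1 : Points (kleinIdeal F) → F) j ≠ 0 := fun j hj => by
  rw [List.mem_singleton.1 hj]
  have h := syndrome_ev φ 1 (fun _ _ => 1) (fun x y => by simp) 21
  have h1 : ev (kleinIdeal F) 1 = 1 := funext fun P => map_one (aeval (R := F) P.1)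
  simp only [one_mul] at h
  rw [h1] at h
  rw [h]
  exact (map_ne_zero_iff φ φ.injective).2 sum_kleinPoints_monomial.2

theorem syndrome_ev_vertical (A : Finset F) (n : ℕ) :
    syndrome (ev (kleinIdeal F) (X 1 * ∏ a ∈ A, (X 0 - C a))) n =
      ∑ m ∈ Finset.range (A.card + 1), (∏ a ∈ A, (Polynomial.X - Polynomial.C a)).coeff m *
        ∑ P, (1 : Points (kleinIdeal F) → F) P * (monoVal (3 * m + 1) P * monoVal n P) := by
  have hdeg : (∏ a ∈ A, (Polynomial.X - Polynomial.C a)).natDegree = A.card := by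
    rw [Polynomial.natDegree_prod_of_monic _ _ fun a _ => Polynomial.monic_X_sub_C a]
    simp
  simp_rw [Finset.mul_sum]
  rw [Finset.sum_comm, syndrome, pairing]
  refine Finset.sum_congr rfl fun P _ => ?_
  have hev : ev (kleinIdeal F) (X 1 * ∏ a ∈ A, (X 0 - C a)) P =
      P.1 1 * (∏ a ∈ A, (Polynomial.X - Polynomial.C a)).eval (P.1 0) := by
    show aeval (R := F) P.1 (X 1 * ∏ a ∈ A, (X 0 - C a)) = _
    simp [Polynomial.eval_prod]
  rw [hev, Polynomial.eval_eq_sum_range, hdeg, Finset.mul_sum, Finset.sum_mul]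
  refine Finset.sum_congr rfl fun m _ => ?_
  rw [monoVal, monoVal, show (3 * m + 1) / 3 = m by omega, show (3 * m + 1) % 3 = 1 by omega,
    Pi.one_apply]
  ring

theorem isKleinWord_vertical (hF : Nat.card F = 8) (φ : GF8 ≃+* F) (A : Finset F) (hA : 0 ∉ A)
    {i : ℕ} (h : (A.card, i) ∈ verticalLevels) :
    IsKleinWord (X 1 * ∏ a ∈ A, (X 0 - C a)) i (3 * (7 - A.card)) := by
  have hcoeff : (∏ a ∈ A, (Polynomial.X - Polynomial.C a)).coeff A.card = 1 := by
    have hmonic := Polynomial.monic_prod_of_monic A (fun a : F => Polynomial.X - Polynomial.C a)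
      fun a _ => Polynomial.monic_X_sub_C a
    have hdeg : (∏ a ∈ A, (Polynomial.X - Polynomial.C a)).natDegree = A.card := by
      rw [Polynomial.natDegree_prod_of_monic _ _ fun a _ => Polynomial.monic_X_sub_C a]
      simp
    rw [← hdeg]
    exact hmonic.coeff_natDegree
  have hzero := syndrome_one_eq_zero φ
  refine isKleinWord_of_syndrome hF (fun n hn hni => ?_) ?_ ?_
  · rw [syndrome_ev_vertical]
    refine Finset.sum_eq_zero fun m hm => ?_
    rw [sum_eq_zero_of_vanishes hF hzero (verticalLevels_vanishes _ h m (Finset.mem_range.1 hm) n hn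
      hni), mul_zero]
  · obtain ⟨n, hn, hni, hs, hv⟩ := verticalLevels_survives _ h
    refine ⟨n, hn, hni, ?_⟩
    rw [syndrome_ev_vertical, Finset.sum_range_succ, hcoeff, one_mul, Finset.sum_eq_zero, zero_add]
    · exact sum_ne_zero_of_survives hF hzero (syndrome_one_ne_zero φ) hs
    · intro m hm
      rw [sum_eq_zero_of_vanishes hF hzero (hv m (Finset.mem_range.1 hm)), mul_zero]
  · obtain ⟨B, rfl⟩ := exists_eq_map φ A
    rw [Finset.card_map, weight_ev φ _ (fun x y => y * ∏ b ∈ B, (x - b))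
      fun x y => by simp [Finset.prod_map]]
    exact card_filter_vertical B fun hB => hA (Finset.mem_map.2 ⟨0, hB, map_zero φ⟩)

/-! ### Distances from words -/

theorem relDist_kleinCode (hF : Nat.card F = 8) {f : MvPolynomial (Fin 2) F} {i w : ℕ}
    (h : IsKleinWord f (i + 1) w) (hi : i < 22) (hw : kleinBound i = w) :
    relDist (kleinCode F i) (kleinCode F (i + 1)) = w :=
  relDist_eq (fun _ hc hc' => hw ▸ kleinBound_le_weight hF hi hc hc') ⟨_, h.1, h.2.1, h.2.2⟩

theorem minDist_kleinCode (hF : Nat.card F = 8) {f : MvPolynomial (Fin 2) F} {i w s : ℕ}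
    (h : IsKleinWord f i w) (hs : s ≤ i - 1) (hw : ∀ j < 22, s ≤ j → w ≤ kleinBound j) :
    minDist (kleinCode F s) = w := by
  refine minDist_eq (fun c hc hc0 => le_weight_of_mem_kleinCode hF hw hc hc0)
    ⟨_, (mem_kleinCode_iff hF _ _).2 fun n hn hns =>
      (mem_kleinCode_iff hF _ _).1 h.1 n hn (hns.trans_le hs), fun h0 => h.2.1 ?_, h.2.2⟩
  rw [h0]
  exact Submodule.zero_mem _

theorem minDist_dualAffineCode (hF : Nat.card F = 8) {f : MvPolynomial (Fin 2) F} {i w s : ℕ}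
    (h : IsKleinWord f (i + 1) w) (hw : ∀ j < 22, s ≤ j → w ≤ kleinBound j)
    {L : Set (Fin 2 →₀ ℕ)} (hs : kleinMonomials F s ⊆ L) (hi : L ⊆ kleinMonomials F i) :
    minDist (dualAffineCode (kleinIdeal F) L) = w := by
  refine minDist_eq
    (fun c hc hc0 => le_weight_of_mem_kleinCode hF hw (dualAffineCode_anti hs hc) hc0)
    ⟨_, dualAffineCode_anti hi h.1, fun h0 => h.2.1 ?_, h.2.2⟩
  rw [h0]
  exact Submodule.zero_mem _

end Words

theorem mainTheorem7 (F : Type*) [Field F] [Finite F] (hF : Nat.card F = 8) :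
    -- sharpness of the estimates: relative distances `d(C(i-1), C(i))`
    (relDist (kleinCode F 6) (kleinCode F 7) = 3 ∧
      relDist (kleinCode F 9) (kleinCode F 10) = 6 ∧
      relDist (kleinCode F 10) (kleinCode F 11) = 8 ∧
      relDist (kleinCode F 12) (kleinCode F 13) = 9 ∧
      relDist (kleinCode F 13) (kleinCode F 14) = 11 ∧
      relDist (kleinCode F 14) (kleinCode F 15) = 12 ∧
      relDist (kleinCode F 15) (kleinCode F 16) = 12 ∧
      relDist (kleinCode F 16) (kleinCode F 17) = 14 ∧
      relDist (kleinCode F 17) (kleinCode F 18) = 15 ∧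
      relDist (kleinCode F 18) (kleinCode F 19) = 15 ∧
      relDist (kleinCode F 19) (kleinCode F 20) = 17 ∧
      relDist (kleinCode F 20) (kleinCode F 21) = 18 ∧
      relDist (kleinCode F 21) (kleinCode F 22) = 21) ∧
    -- minimum distances of `C^⊥(I, L)` for intermediate sets `L`
    (∀ L : Set (Fin 2 →₀ ℕ), kleinMonomials F 3 ⊆ L → L ⊆ kleinMonomials F 6 →
      minDist (dualAffineCode (kleinIdeal F) L) = 3) ∧
    (∀ L : Set (Fin 2 →₀ ℕ), kleinMonomials F 7 ⊆ L → L ⊆ kleinMonomials F 9 →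
      minDist (dualAffineCode (kleinIdeal F) L) = 6) ∧
    -- minimum distances `d(C(s))`
    (minDist (kleinCode F 3) = 3 ∧ minDist (kleinCode F 4) = 3 ∧
      minDist (kleinCode F 5) = 3 ∧ minDist (kleinCode F 6) = 3 ∧
      minDist (kleinCode F 7) = 6 ∧ minDist (kleinCode F 8) = 6 ∧ minDist (kleinCode F 9) = 6 ∧
      minDist (kleinCode F 10) = 8 ∧
      minDist (kleinCode F 12) = 9 ∧
      minDist (kleinCode F 13) = 11 ∧
      minDist (kleinCode F 14) = 12 ∧ minDist (kleinCode F 15) = 12 ∧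
      minDist (kleinCode F 16) = 14 ∧
      minDist (kleinCode F 18) = 15 ∧
      minDist (kleinCode F 19) = 17 ∧
      minDist (kleinCode F 20) = 18 ∧
      minDist (kleinCode F 21) = 21) ∧
    -- explicit words of these weights
    (∀ A : Finset F, 0 ∉ A → ∀ i w : ℕ,
      (A.card, i, w) ∈ ({(6, 7, 3), (5, 10, 6), (4, 13, 9), (3, 16, 12), (2, 19, 15), (1, 21, 18),
        (0, 22, 21)} : Set (ℕ × ℕ × ℕ)) →
      IsKleinWord (X 1 * ∏ a ∈ A, (X 0 - C a)) i w) ∧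
    (∀ α : F, α ^ 3 + α ^ 2 + 1 = 0 →
      (∀ A : Finset F, (∀ a ∈ A, a = α ∨ a = α ^ 2 + α ∨ a = α ^ 2 + α + 1) → ∀ i w : ℕ,
        (A.card, i, w) ∈ ({(3, 11, 8), (2, 14, 11), (1, 17, 14), (0, 20, 17)} :
          Set (ℕ × ℕ × ℕ)) →
        IsKleinWord (X 1 * (X 0 + X 1 + C α) * ∏ a ∈ A, (X 0 - C a)) i w) ∧
      IsKleinWord (C α * X 0 ^ 3 * X 1 + C α * X 0 * X 1 ^ 2 + C (α ^ 2 + α + 1) * X 1 ^ 2 +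
        C (α ^ 2 + α + 1) * X 0 * X 1 + C (α + 1) * X 1 + X 0) 15 12 ∧
      IsKleinWord (C α * X 0 ^ 2 * X 1 + 1) 18 15) := by
  have := charP_two_of_card_eq_eight hF
  have vertical : ∀ (k i : ℕ), (k, i) ∈ verticalLevels → k ≤ 7 →
      ∃ f : MvPolynomial (Fin 2) F, IsKleinWord f i (3 * (7 - k)) := fun k i h hk => by
    classical
    obtain ⟨α, hα⟩ := exists_cubic_root hF
    obtain ⟨φ, -⟩ := GF8.exists_ringEquiv hF α hα
    have := Fintype.ofFinite F
    obtain ⟨A, hA, rfl⟩ := Finset.exists_subset_card_eq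
      (s := (Finset.univ : Finset F).erase 0) (n := k) (by
        rwa [Finset.card_erase_of_mem (Finset.mem_univ _), Finset.card_univ,
          ← Nat.card_eq_fintype_card, hF])
    exact ⟨_, isKleinWord_vertical hF φ A (fun h0 => Finset.notMem_erase 0 _ (hA h0)) h⟩
  have line : ∀ (k i w : ℕ), (k, i, w) ∈ ([(3, 11, 8), (2, 14, 11), (1, 17, 14), (0, 20, 17)] :
      List (ℕ × ℕ × ℕ)) → k ≤ 3 → ∃ f : MvPolynomial (Fin 2) F, IsKleinWord f i w :=
      fun k i w h hk => by
    obtain ⟨α, hα⟩ := exists_cubic_root hF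
    obtain ⟨φ, -⟩ := GF8.exists_ringEquiv hF α hα
    obtain ⟨B, hB, rfl⟩ := Finset.exists_subset_card_eq (s := avoidingFibres) (n := k)
      (hk.trans (by decide +kernel))
    refine ⟨_, isKleinWord_line hF φ (B.map φ.toEquiv.toEmbedding) (fun a ha => ?_) i w
      (by rwa [Finset.card_map])⟩
    obtain ⟨b, hb, rfl⟩ := Finset.mem_map.1 ha
    have := hB hb
    simp only [avoidingFibres, Finset.mem_insert, Finset.mem_singleton] at this
    rcases this with rfl | rfl | rfl <;> simp
  have special : (∃ f : MvPolynomial (Fin 2) F, IsKleinWord f 15 12) ∧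
      ∃ f : MvPolynomial (Fin 2) F, IsKleinWord f 18 15 := by
    obtain ⟨α, hα⟩ := exists_cubic_root hF
    obtain ⟨φ, -⟩ := GF8.exists_ringEquiv hF α hα
    exact ⟨⟨_, isKleinWord_cubic hF φ⟩, ⟨_, isKleinWord_binomial hF φ⟩⟩
  obtain ⟨_, w7⟩ := vertical 6 7 (by decide) (by decide)
  obtain ⟨_, w10⟩ := vertical 5 10 (by decide) (by decide)
  obtain ⟨_, w11⟩ := line 3 11 8 (by decide) (by decide)
  obtain ⟨_, w13⟩ := vertical 4 13 (by decide) (by decide)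
  obtain ⟨_, w14⟩ := line 2 14 11 (by decide) (by decide)
  obtain ⟨⟨_, w15⟩, ⟨_, w18⟩⟩ := special
  obtain ⟨_, w16⟩ := vertical 3 16 (by decide) (by decide)
  obtain ⟨_, w17⟩ := line 1 17 14 (by decide) (by decide)
  obtain ⟨_, w19⟩ := vertical 2 19 (by decide) (by decide)
  obtain ⟨_, w20⟩ := line 0 20 17 (by decide) (by decide)
  obtain ⟨_, w21⟩ := vertical 1 21 (by decide) (by decide)
  obtain ⟨_, w22⟩ := vertical 0 22 (by decide) (by decide)
  refine ⟨⟨?_, ?_, ?_, ?_, ?_, ?_, ?_, ?_, ?_, ?_, ?_, ?_, ?_⟩, fun L h3 h6 => ?_,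
    fun L h7 h9 => ?_, ⟨?_, ?_, ?_, ?_, ?_, ?_, ?_, ?_, ?_, ?_, ?_, ?_, ?_, ?_, ?_, ?_, ?_⟩,
    fun A hA i w h => ?_, fun α hα => ?_⟩
  · exact relDist_kleinCode hF w7 (by decide) rfl
  · exact relDist_kleinCode hF w10 (by decide) rfl
  · exact relDist_kleinCode hF w11 (by decide) rfl
  · exact relDist_kleinCode hF w13 (by decide) rfl
  · exact relDist_kleinCode hF w14 (by decide) rfl
  · exact relDist_kleinCode hF w15 (by decide) rfl
  · exact relDist_kleinCode hF w16 (by decide) rfl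
  · exact relDist_kleinCode hF w17 (by decide) rfl
  · exact relDist_kleinCode hF w18 (by decide) rfl
  · exact relDist_kleinCode hF w19 (by decide) rfl
  · exact relDist_kleinCode hF w20 (by decide) rfl
  · exact relDist_kleinCode hF w21 (by decide) rfl
  · exact relDist_kleinCode hF w22 (by decide) rfl
  · exact minDist_dualAffineCode hF w7 (by decide) h3 h6
  · exact minDist_dualAffineCode hF w10 (by decide) h7 h9
  · exact minDist_kleinCode hF w7 (by decide) (by decide)
  · exact minDist_kleinCode hF w7 (by decide) (by decide)
  · exact minDist_kleinCode hF w7 (by decide) (by decide)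
  · exact minDist_kleinCode hF w7 (by decide) (by decide)
  · exact minDist_kleinCode hF w10 (by decide) (by decide)
  · exact minDist_kleinCode hF w10 (by decide) (by decide)
  · exact minDist_kleinCode hF w10 (by decide) (by decide)
  · exact minDist_kleinCode hF w11 (by decide) (by decide)
  · exact minDist_kleinCode hF w13 (by decide) (by decide)
  · exact minDist_kleinCode hF w14 (by decide) (by decide)
  · exact minDist_kleinCode hF w15 (by decide) (by decide)
  · exact minDist_kleinCode hF w16 (by decide) (by decide)
  · exact minDist_kleinCode hF w17 (by decide) (by decide)
  · exact minDist_kleinCode hF w19 (by decide) (by decide)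
  · exact minDist_kleinCode hF w20 (by decide) (by decide)
  · exact minDist_kleinCode hF w21 (by decide) (by decide)
  · exact minDist_kleinCode hF w22 (by decide) (by decide)
  · obtain ⟨α, hα⟩ := exists_cubic_root hF
    obtain ⟨φ, -⟩ := GF8.exists_ringEquiv hF α hα
    have hmem : (A.card, i) ∈ verticalLevels ∧ w = 3 * (7 - A.card) := by
      simp only [Set.mem_insert_iff, Set.mem_singleton_iff, Prod.mk.injEq] at h
      rcases h with ⟨h, rfl, rfl⟩ | ⟨h, rfl, rfl⟩ | ⟨h, rfl, rfl⟩ | ⟨h, rfl, rfl⟩ | ⟨h, rfl, rfl⟩ |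
        ⟨h, rfl, rfl⟩ | ⟨h, rfl, rfl⟩ <;> rw [h] <;> decide
    exact hmem.2 ▸ isKleinWord_vertical hF φ A hA hmem.1
  · obtain ⟨φ, rfl⟩ := GF8.exists_ringEquiv hF α hα
    exact ⟨fun A hA i w h => isKleinWord_line hF φ A hA i w (by simpa using h),
      isKleinWord_cubic hF φ, isKleinWord_binomial hF φ⟩
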